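/- All graphs are finite and simple. A combinatorial embedding of a graph assigns to each vertex a cyclic order of the directed edges starting there; the directed edge following $e$ in this order is $\mathrm{nx}(e)$, and the faces are the cycles of the permutation $e\mapsto \mathrm{nx}(e^{-1})$ of the directed edges. Its mirror image reverses all the cyclic orders, and for a connected graph with at least one edge its genus $g$ is given by Euler's formula: (number of vertices) $-$ (number of edges) $+$ (number of faces) $=2-2g$. An embedding of a connected graph is polyhedral if each facial walk is a simple cycle (of length at least $3$) and the intersection of any two different faces is empty, a single vertex, or a single edge (with its two end vertices). For a graph $G$ and an integer $g\ge 0$ let $n_g(G)$ be the number of polyhedral embeddings of $G$ of genus $g$, where mirror images are identified (but isomorphic embeddings that are neither equal nor mirror images are counted separately); $n_g(G)=0$ if $G$ is disconnected. Let $G$ and $G'$ be graphs, let $v$ be a vertex of degree $3$ of $G$ with neighbours $a,b,c$, and let $v'$ be a vertex of degree $3$ of $G'$ with neighbours $a',b',c'$. Let $G_v\star G'_{v'}$ be the graph obtained from the disjoint union of $G-v$ and $G'-v'$ by adding the three edges $\{a,a'\},\{b,b'\},\{c,c'\}$ (the neighbours may be named in any order). If $G'$ is 3-connected and planar, then $n_g(G_v\star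 G'_{v'})=n_g(G)$ for all integers $g\ge 0$. -/

import Mathlib

/-- A combinatorial embedding (rotation system) of a graph: a permutation `next` of the directed
edges whose cycles are exactly the sets of directed edges starting at a common vertex.  Thus
`next e` is the next directed edge after `e` in the rotational order around the start of `e`. -/
@[ext] structure RotationSystem {V : Type*} (G : SimpleGraph V) where
  next : Equiv.Perm G.Dart
  next_fst : ∀ e : G.Dart, (next e).fst = e.fst
  sameCycle : ∀ e f : G.Dart, e.fst = f.fst → next.SameCycle e f

namespace RotationSystem

variable {V : Type*} {G : SimpleGraph V}

/-- The mirror image: every cyclic order is reversed. -/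
def mirror (R : RotationSystem G) : RotationSystem G where
  next := R.next⁻¹
  next_fst e := by
    have h := R.next_fst (R.next⁻¹ e)
    have h' : R.next (R.next⁻¹ e) = e := R.next.apply_symm_apply e
    rw [h'] at h
    exact h.symm
  sameCycle e f h := (R.sameCycle e f h).inv

theorem mirror_mirror (R : RotationSystem G) : R.mirror.mirror = R := by
  ext1
  exact inv_inv R.next

/-- Two rotation systems represent the same embedding if they are equal or mirror images. -/
def mirrorSetoid (G : SimpleGraph V) : Setoid (RotationSystem G) where
  r R S := S = R ∨ S = R.mirror
  iseqv :=
    { refl := fun _ => Or.inl rfl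
      symm := by
        rintro R S (rfl | rfl)
        · exact Or.inl rfl
        · exact Or.inr R.mirror_mirror.symm
      trans := by
        rintro R S T (rfl | rfl) (rfl | rfl)
        · exact Or.inl rfl
        · exact Or.inr rfl
        · exact Or.inr rfl
        · exact Or.inl R.mirror_mirror }

/-- The permutation `e ↦ next (e⁻¹)` of the directed edges; its cycles are the facial walks. -/
def faceNext (R : RotationSystem G) : Equiv.Perm G.Dart :=
  (Function.Involutive.toPerm SimpleGraph.Dart.symm SimpleGraph.Dart.symm_involutive).trans R.next

/-- The set of directed edges of the facial walk through `d`. -/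
def faceDarts (R : RotationSystem G) (d : G.Dart) : Set G.Dart :=
  {e | R.faceNext.SameCycle d e}

/-- The subgraph formed by the vertices and the edges of the facial walk through `d`. -/
def faceSubgraph (R : RotationSystem G) (d : G.Dart) : G.Subgraph where
  verts := {x | ∃ e ∈ R.faceDarts d, x = e.fst ∨ x = e.snd}
  Adj x y := ∃ e ∈ R.faceDarts d, s(x, y) = e.edge
  adj_sub := by
    rintro x y ⟨e, -, h⟩
    have he := e.edge_mem
    rw [← h] at he
    exact he
  edge_vert := by
    rintro x y ⟨e, he, h⟩
    refine ⟨e, he, ?_⟩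
    have hx : x ∈ s(x, y) := Sym2.mem_mk_left x y
    rw [h] at hx
    exact Sym2.mem_iff.mp hx
  symm := ⟨fun x y ⟨e, he, h⟩ => ⟨e, he, by rw [Sym2.eq_swap]; exact h⟩⟩

/-- The number of faces.  An isolated vertex carries no directed edge and
contributes one face (the complement of a point on its sphere). -/
noncomputable def numFaces (R : RotationSystem G) : ℕ :=
  Nat.card (Quotient (Equiv.Perm.SameCycle.setoid R.faceNext)) +
    Nat.card {x : V // ∀ y, ¬ G.Adj x y}

/-- The embedding has genus `g`, by Euler's formula.  For a connected graph this reads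
`v - e + f = 2 - 2 * g`; in general the genera of the components are added. -/
def HasGenus (R : RotationSystem G) (g : ℕ) : Prop :=
  Nat.card V + R.numFaces + 2 * g = Nat.card G.edgeSet + 2 * Nat.card G.ConnectedComponent

/-- The embedding is polyhedral: the graph is connected, each facial walk is a simple cycle (it has
length at least 3 and does not repeat a vertex), and the intersection of two different faces is
empty, a single vertex, or a single edge (together with its two end vertices). -/
structure IsPolyhedral (R : RotationSystem G) : Prop where
  connected : G.Connected
  three_le_length : ∀ d : G.Dart, 3 ≤ (R.faceDarts d).ncard
  simple : ∀ d : G.Dart, Set.InjOn (fun e : G.Dart => e.fst) (R.faceDarts d)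
  inter : ∀ d d' : G.Dart, ¬ R.faceNext.SameCycle d d' →
    R.faceSubgraph d ⊓ R.faceSubgraph d' = ⊥ ∨
    (∃ x : V, R.faceSubgraph d ⊓ R.faceSubgraph d' = G.singletonSubgraph x) ∨
    ∃ (x y : V) (h : G.Adj x y), R.faceSubgraph d ⊓ R.faceSubgraph d' = G.subgraphOfAdj h

end RotationSystem

/-- `n_g(G)`: the number of polyhedral embeddings of `G` of genus `g`, mirror images identified. -/
noncomputable def numPolyhedral {V : Type*} (G : SimpleGraph V) (g : ℕ) : ℕ :=
  (Quotient.mk (RotationSystem.mirrorSetoid G) ''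
    {R : RotationSystem G | R.IsPolyhedral ∧ R.HasGenus g}).ncard

/-- A finite graph is planar if it has a combinatorial embedding of genus 0. -/
def IsPlanarGraph {V : Type*} (G : SimpleGraph V) : Prop :=
  ∃ R : RotationSystem G, R.HasGenus 0

/-- `k`-connectedness: more than `k` vertices, and connected after the deletion of
fewer than `k` vertices. -/
def IsVertexConnected {V : Type*} (G : SimpleGraph V) (k : ℕ) : Prop :=
  k < Nat.card V ∧ ∀ S : Finset V, S.card < k → (G.induce {x : V | x ∉ S}).Connected

/-- The star product of `G` and `G'` at `v` and `v'`: the vertices `v` and `v'` are deleted, and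
every neighbour `x` of `v` is joined to the neighbour `σ x` of `v'`. -/
def starProduct {V W : Type*} (G : SimpleGraph V) (v : V) (G' : SimpleGraph W) (v' : W)
    (σ : G.neighborSet v ≃ G'.neighborSet v') :
    SimpleGraph ({x : V // x ≠ v} ⊕ {y : W // y ≠ v'}) where
  Adj
    | Sum.inl x, Sum.inl y => G.Adj x y
    | Sum.inr x, Sum.inr y => G'.Adj x y
    | Sum.inl x, Sum.inr y => ∃ h : (x : V) ∈ G.neighborSet v, (σ ⟨x, h⟩ : W) = y
    | Sum.inr y, Sum.inl x => ∃ h : (x : V) ∈ G.neighborSet v, (σ ⟨x, h⟩ : W) = y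
  symm := ⟨by
    rintro (x | x) (y | y) h
    · exact G.adj_symm h
    · exact h
    · exact h
    · exact G'.adj_symm h⟩
  loopless := ⟨by
    rintro (x | x) h
    · exact G.irrefl h
    · exact G'.irrefl h⟩

/-!
Let `H` be the star product of `G` and `G'`.  It is handled through its two contractions:
contracting the vertices of `G'` in `H` to the vertex `v` gives `G`, and contracting those of `G`
to `v'` gives `G'`.

**Cutting and gluing.**  A facial walk of a polyhedral embedding `S` of `H` crosses the cut with
three edges equally often in both directions, and it does not use an edge twice.  So it crosses
the cut at most once in each direction (`Contraction.ncard_exits_le_one`), and continuing each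
face that leaves `G` with the place where it comes back defines a rotation system of `G`, and
similarly one of `G'` (`Contraction.exists_induces`); their rotations at `v` and `v'` are opposite
to each other (`IsGluing.of_induces`).  Conversely, a pair of rotation systems of `G` and `G'`
with this matching property determines one of `H`.  The faces of `G` are the parts of the faces of
`H` outside `G'` (`IsGluing.sameFace_lift_iff`), so `S` is polyhedral if and only if both parts
are, and counting faces shows that the genus is additive (`IsGluing.card_faces`).

**Planar graphs.**  It remains to see that the 3-connected planar graph `G'` has, up to
reflection, one polyhedral embedding, that it is the spherical one, and that it exists.  Both
parts rest on the vanishing of the homology modulo two of a spherical map,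
`exists_coboundary_of_sum_eq_zero`, a dimension count by Euler's formula.

* A spherical embedding of a 3-connected graph is polyhedral: if a face passes twice through a
  vertex, or if two faces share two vertices, then the edges between the two passages form a
  cocycle, hence a cut, and this contradicts 3-connectedness (`simple_of_isVertexConnected`,
  `next_eq_of_common_vertices`).
* Let `R` be a polyhedral embedding of any genus and `P` a spherical one.  The facial cycles of
  `R` are induced and non-separating (`IsPolyhedralMap.exists_forall_offFace_eq`).  Each of them
  bounds in `P`, and by the former property one of its two sides contains no further edges, so it
  is a facial cycle of `P`.  Hence `R` is `P` or its mirror image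
  (`IsPolyhedralMap.eq_or_eq_mirror_of_hasGenus_zero`).

Since exactly one of the two mirror images of the embedding of `G'` fits a given rotation at `v`,
gluing it in is a bijection from the polyhedral embeddings of `G` of genus `g` to those of `H`,
and it commutes with reflection.
-/

/-! ### Facial walks and polyhedral embeddings -/

/-- A property that is preserved by a permutation of a finite type spreads along its cycles. -/
theorem Equiv.Perm.SameCycle.induction {α : Type*} [Finite α] {f : Equiv.Perm α} {x y : α}
    (h : f.SameCycle x y) {p : α → Prop} (hx : p x) (step : ∀ z, f.SameCycle x z → p z → p (f z)) :
    p y := by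
  obtain ⟨n, rfl⟩ := h.exists_nat_pow_eq
  clear h
  induction n with
  | zero => exact hx
  | succ n ih =>
    rw [pow_succ', Equiv.Perm.mul_apply]
    exact step _ ⟨n, by simp⟩ ih

instance SimpleGraph.finite_dart {V : Type*} [Finite V] (G : SimpleGraph V) : Finite G.Dart :=
  Finite.of_injective _ SimpleGraph.Dart.toProd_injective

theorem SimpleGraph.Dart.eq_of_fst_of_snd {V : Type*} {G : SimpleGraph V} {d e : G.Dart}
    (h₁ : d.fst = e.fst) (h₂ : d.snd = e.snd) : d = e :=
  SimpleGraph.Dart.ext _ _ (Prod.ext h₁ h₂)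

namespace RotationSystem

variable {V : Type*} {G : SimpleGraph V}

theorem faceNext_apply (R : RotationSystem G) (d : G.Dart) : R.faceNext d = R.next d.symm := rfl

theorem faceNext_symm (R : RotationSystem G) (d : G.Dart) : R.faceNext d.symm = R.next d := by
  rw [faceNext_apply, SimpleGraph.Dart.symm_symm]

theorem fst_faceNext (R : RotationSystem G) (d : G.Dart) : (R.faceNext d).fst = d.snd :=
  R.next_fst d.symm

theorem faceNext_inv_apply (R : RotationSystem G) (d : G.Dart) :
    R.faceNext⁻¹ d = (R.next⁻¹ d).symm := by
  rw [Equiv.Perm.inv_eq_iff_eq, faceNext_symm]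
  simp

theorem next_next_inv (R : RotationSystem G) (d : G.Dart) : R.next (R.next⁻¹ d) = d :=
  R.next.apply_symm_apply d

theorem faceNext_faceNext_inv (R : RotationSystem G) (d : G.Dart) :
    R.faceNext (R.faceNext⁻¹ d) = d :=
  R.faceNext.apply_symm_apply d

theorem next_inv_fst (R : RotationSystem G) (d : G.Dart) : (R.next⁻¹ d).fst = d.fst := by
  have h := R.next_fst (R.next⁻¹ d)
  simpa using h.symm

theorem next_pow_fst (R : RotationSystem G) (d : G.Dart) (n : ℕ) :
    ((R.next ^ n) d).fst = d.fst := by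
  induction n with
  | zero => rfl
  | succ n ih => rw [pow_succ', Equiv.Perm.mul_apply, R.next_fst, ih]

theorem fst_eq_of_sameCycle [Finite V] (R : RotationSystem G) {d e : G.Dart}
    (h : R.next.SameCycle d e) : d.fst = e.fst :=
  h.induction (p := fun e => d.fst = e.fst) rfl fun z _ hz => by rw [R.next_fst, hz]

/-- `R.SameFace d e`: the directed edges `d` and `e` lie on the same facial walk. -/
def SameFace (R : RotationSystem G) (d e : G.Dart) : Prop := R.faceNext.SameCycle d e

variable {R : RotationSystem G}

theorem SameFace.refl (R : RotationSystem G) (d : G.Dart) : R.SameFace d d :=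
  Equiv.Perm.SameCycle.refl _ _

theorem SameFace.symm {d e : G.Dart} (h : R.SameFace d e) : R.SameFace e d :=
  Equiv.Perm.SameCycle.symm h

theorem SameFace.trans {d e f : G.Dart} (h : R.SameFace d e) (h' : R.SameFace e f) :
    R.SameFace d f :=
  Equiv.Perm.SameCycle.trans h h'

theorem sameFace_faceNext (R : RotationSystem G) (d : G.Dart) : R.SameFace d (R.faceNext d) :=
  ⟨1, by simp⟩

theorem SameFace.faceNext {d e : G.Dart} (h : R.SameFace d e) : R.SameFace d (R.faceNext e) :=
  h.trans (R.sameFace_faceNext e)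

theorem SameFace.faceNext_inv {d e : G.Dart} (h : R.SameFace d e) :
    R.SameFace d (R.faceNext⁻¹ e) :=
  h.trans (SameFace.symm (by simpa using R.sameFace_faceNext (R.faceNext⁻¹ e)))

theorem sameFace_symm_next (R : RotationSystem G) (d : G.Dart) : R.SameFace d.symm (R.next d) := by
  simpa [faceNext_symm] using R.sameFace_faceNext d.symm

/-- The vertex `x` lies on the facial walk through `d`. -/
def OnFace (R : RotationSystem G) (d : G.Dart) (x : V) : Prop := ∃ e, R.SameFace d e ∧ e.fst = x

theorem SameFace.onFace_fst {d e : G.Dart} (h : R.SameFace d e) : R.OnFace d e.fst := ⟨e, h, rfl⟩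

theorem SameFace.onFace_snd {d e : G.Dart} (h : R.SameFace d e) : R.OnFace d e.snd :=
  ⟨_, h.faceNext, R.fst_faceNext e⟩

theorem SameFace.onFace {d e : G.Dart} (h : R.SameFace d e) {x : V} (hx : R.OnFace e x) :
    R.OnFace d x :=
  let ⟨f, hf, hx⟩ := hx
  ⟨f, h.trans hf, hx⟩

theorem mem_verts_faceSubgraph {d : G.Dart} {x : V} :
    x ∈ (R.faceSubgraph d).verts ↔ R.OnFace d x := by
  constructor
  · rintro ⟨e, he, rfl | rfl⟩
    · exact SameFace.onFace_fst he
    · exact SameFace.onFace_snd he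
  · rintro ⟨e, he, rfl⟩
    exact ⟨e, he, Or.inl rfl⟩

/-- The adjacency of the subgraph of a face in terms of directed edges. -/
theorem adj_faceSubgraph {d : G.Dart} {x y : V} :
    (R.faceSubgraph d).Adj x y ↔
      ∃ e, (R.SameFace d e ∨ R.SameFace d e.symm) ∧ e.fst = x ∧ e.snd = y := by
  constructor
  · rintro ⟨e, he, h⟩
    have h' : s(x, y) = s(e.fst, e.snd) := h
    rcases Sym2.eq_iff.mp h' with ⟨rfl, rfl⟩ | ⟨rfl, rfl⟩
    · exact ⟨e, Or.inl he, rfl, rfl⟩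
    · exact ⟨e.symm, Or.inr (by rw [SimpleGraph.Dart.symm_symm]; exact he), rfl, rfl⟩
  · rintro ⟨e, he | he, rfl, rfl⟩
    · exact ⟨e, he, rfl⟩
    · exact ⟨e.symm, he, by rw [SimpleGraph.Dart.edge_symm]; rfl⟩

/-- Polyhedrality in terms of directed edges: the graph is connected, no vertex has degree one, no
facial walk repeats a vertex, and two faces sharing two vertices share an edge, which they traverse
in opposite directions, and no vertex off this edge. -/
structure IsPolyhedralMap (R : RotationSystem G) : Prop where
  connected : G.Connected
  next_ne : ∀ e, R.next e ≠ e
  simple : ∀ ⦃d e : G.Dart⦄, R.SameFace d e → d.fst = e.fst → d = e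
  inter : ∀ ⦃d d' : G.Dart⦄, ¬ R.SameFace d d' → ∀ ⦃x y : V⦄, x ≠ y →
    R.OnFace d x → R.OnFace d' x → R.OnFace d y → R.OnFace d' y →
    ∃ e, R.SameFace d e ∧ R.SameFace d' e.symm ∧
      ∀ z, R.OnFace d z → R.OnFace d' z → z = e.fst ∨ z = e.snd

namespace IsPolyhedralMap

theorem snd_faceNext_ne (h : R.IsPolyhedralMap) (d : G.Dart) : (R.faceNext d).snd ≠ d.fst := by
  intro hd
  have : R.faceNext d = d.symm :=
    SimpleGraph.Dart.eq_of_fst_of_snd (R.fst_faceNext d) hd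
  exact h.next_ne d.symm this

theorem not_sameFace_symm (h : R.IsPolyhedralMap) (d : G.Dart) : ¬ R.SameFace d d.symm := by
  intro hd
  have h' : R.faceNext d = d.symm :=
    h.simple (SameFace.symm (R.sameFace_faceNext d) |>.trans hd) (R.fst_faceNext d)
  exact h.next_ne d.symm h'

end IsPolyhedralMap

theorem three_le_ncard_faceDarts [Finite V] (hn : ∀ e, R.next e ≠ e) (d : G.Dart) :
    3 ≤ (R.faceDarts d).ncard := by
  have h1 : R.faceNext d ≠ d := fun h => by
    have := R.fst_faceNext d
    rw [h] at this
    exact d.fst_ne_snd this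
  have h2 : R.faceNext (R.faceNext d) ≠ R.faceNext d := fun h => h1 (R.faceNext.injective h)
  have h3 : R.faceNext (R.faceNext d) ≠ d := fun h => by
    have h4 := R.fst_faceNext (R.faceNext d)
    rw [h] at h4
    have : R.faceNext d = d.symm :=
      SimpleGraph.Dart.eq_of_fst_of_snd (R.fst_faceNext d) h4.symm
    exact hn d.symm this
  have hs : ({d, R.faceNext d, R.faceNext (R.faceNext d)} : Set G.Dart) ⊆ R.faceDarts d := by
    have h0 := SameFace.refl R d
    rintro e (rfl | rfl | rfl)
    · exact h0
    · exact h0.faceNext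
    · exact h0.faceNext.faceNext
  calc 3 = ({d, R.faceNext d, R.faceNext (R.faceNext d)} : Set G.Dart).ncard :=
        (Set.ncard_eq_three.mpr ⟨_, _, _, h1.symm, h3.symm, h2.symm, rfl⟩).symm
    _ ≤ _ := Set.ncard_le_ncard hs (Set.toFinite _)

theorem IsPolyhedralMap.isPolyhedral [Finite V] (h : R.IsPolyhedralMap) : R.IsPolyhedral where
  connected := h.connected
  three_le_length := three_le_ncard_faceDarts h.next_ne
  simple d e he f hf hef := h.simple (SameFace.trans (SameFace.symm he) hf) hef
  inter d d' hd := by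
    have hv : ∀ {x}, x ∈ (R.faceSubgraph d ⊓ R.faceSubgraph d').verts ↔
        R.OnFace d x ∧ R.OnFace d' x := fun {x} => by
      rw [SimpleGraph.Subgraph.verts_inf]
      exact and_congr mem_verts_faceSubgraph mem_verts_faceSubgraph
    by_cases h0 : ∃ x, R.OnFace d x ∧ R.OnFace d' x
    · obtain ⟨x, hx, hx'⟩ := h0
      by_cases h1 : ∃ y, x ≠ y ∧ R.OnFace d y ∧ R.OnFace d' y
      · obtain ⟨y, hxy, hy, hy'⟩ := h1
        obtain ⟨e, he, he', hz⟩ := h.inter hd hxy hx hx' hy hy'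
        refine Or.inr (Or.inr ⟨e.fst, e.snd, e.adj, ?_⟩)
        refine SimpleGraph.Subgraph.ext ?_ ?_
        · ext z
          rw [hv, SimpleGraph.subgraphOfAdj_verts]
          constructor
          · exact fun hz' => hz z hz'.1 hz'.2
          · rintro (rfl | rfl)
            · exact ⟨he.onFace_fst, he'.onFace_snd⟩
            · exact ⟨he.onFace_snd, he'.onFace_fst⟩
        · ext z w
          rw [SimpleGraph.subgraphOfAdj_adj, SimpleGraph.Subgraph.inf_adj]
          constructor
          · intro hzw
            have hne : z ≠ w := ((R.faceSubgraph d).adj_sub hzw.1).ne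
            have hz1 := hz z (mem_verts_faceSubgraph.mp ((R.faceSubgraph d).edge_vert hzw.1))
              (mem_verts_faceSubgraph.mp ((R.faceSubgraph d').edge_vert hzw.2))
            have hw1 := hz w (mem_verts_faceSubgraph.mp ((R.faceSubgraph d).edge_vert hzw.1.symm))
              (mem_verts_faceSubgraph.mp ((R.faceSubgraph d').edge_vert hzw.2.symm))
            rw [Sym2.eq_iff]
            rcases hz1 with rfl | rfl <;> rcases hw1 with rfl | rfl <;> simp_all
          · intro hzw
            rcases Sym2.eq_iff.mp hzw with ⟨rfl, rfl⟩ | ⟨rfl, rfl⟩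
            · exact ⟨adj_faceSubgraph.mpr ⟨e, Or.inl he, rfl, rfl⟩,
                adj_faceSubgraph.mpr ⟨e, Or.inr he', rfl, rfl⟩⟩
            · exact ⟨adj_faceSubgraph.mpr ⟨e.symm, Or.inr (by simpa using he), rfl, rfl⟩,
                adj_faceSubgraph.mpr ⟨e.symm, Or.inl he', rfl, rfl⟩⟩
      · push Not at h1
        refine Or.inr (Or.inl ⟨x, SimpleGraph.Subgraph.ext ?_ ?_⟩)
        · ext z
          rw [hv, SimpleGraph.singletonSubgraph_verts, Set.mem_singleton_iff]
          constructor
          · intro hz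
            by_contra hzx
            exact h1 z (Ne.symm hzx) hz.1 hz.2
          · rintro rfl
            exact ⟨hx, hx'⟩
        · ext z w
          simp only [SimpleGraph.singletonSubgraph_adj, SimpleGraph.Subgraph.inf_adj]
          refine iff_of_false (fun hzw => ?_) (fun h => h)
          have hne : z ≠ w := ((R.faceSubgraph d).adj_sub hzw.1).ne
          have key : ∀ {a b}, (R.faceSubgraph d).Adj a b → (R.faceSubgraph d').Adj a b → x = a :=
            fun {a b} h2 h3 => by
              by_contra hxa
              exact h1 a hxa (mem_verts_faceSubgraph.mp ((R.faceSubgraph d).edge_vert h2))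
                (mem_verts_faceSubgraph.mp ((R.faceSubgraph d').edge_vert h3))
          exact hne ((key hzw.1 hzw.2).symm.trans (key hzw.1.symm hzw.2.symm))
    · refine Or.inl ?_
      rw [SimpleGraph.Subgraph.eq_bot_iff_verts_eq_empty, Set.eq_empty_iff_forall_notMem]
      exact fun x hx => h0 ⟨x, hv.mp hx⟩

theorem IsPolyhedral.next_ne [Finite V] (h : R.IsPolyhedral) (e : G.Dart) : R.next e ≠ e := by
  intro he
  have h1 : R.faceNext e.symm = e := by rw [faceNext_symm, he]
  have h0 := SameFace.refl R e
  have h2 : R.faceNext e = e.symm := by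
    refine h.simple e h0.faceNext (R := R) ?_ (by simpa using R.fst_faceNext e)
    have : R.SameFace e.symm e := by
      have := R.sameFace_faceNext e.symm
      rwa [h1] at this
    exact this.symm
  have h3 := h.three_le_length e
  have h4 : R.faceDarts e ⊆ {e, e.symm} := fun f hf => by
    refine Equiv.Perm.SameCycle.induction (f := R.faceNext)
      (p := fun f => f ∈ ({e, e.symm} : Set G.Dart)) hf (by simp) ?_
    rintro z - (rfl | rfl)
    · simp [h2]
    · simp [h1]
  have h5 := (Set.ncard_le_ncard h4 (Set.toFinite _)).trans (Set.ncard_insert_le _ _)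
  rw [Set.ncard_singleton] at h5
  omega

theorem IsPolyhedral.isPolyhedralMap [Finite V] (h : R.IsPolyhedral) : R.IsPolyhedralMap where
  connected := h.connected
  next_ne := h.next_ne
  simple d e hde hf := h.simple d (SameFace.refl R d) hde hf
  inter d d' hd x y hxy hx hx' hy hy' := by
    have hx1 : x ∈ (R.faceSubgraph d ⊓ R.faceSubgraph d').verts :=
      ⟨mem_verts_faceSubgraph.mpr hx, mem_verts_faceSubgraph.mpr hx'⟩
    have hy1 : y ∈ (R.faceSubgraph d ⊓ R.faceSubgraph d').verts :=
      ⟨mem_verts_faceSubgraph.mpr hy, mem_verts_faceSubgraph.mpr hy'⟩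
    rcases h.inter d d' hd with h0 | ⟨z, h0⟩ | ⟨a, b, hab, h0⟩
    · rw [h0] at hx1
      exact hx1.elim
    · rw [h0] at hx1 hy1
      exact absurd ((Set.mem_singleton_iff.mp hx1).trans (Set.mem_singleton_iff.mp hy1).symm) hxy
    · have hadj : (R.faceSubgraph d ⊓ R.faceSubgraph d').Adj a b := by rw [h0]; rfl
      have hverts : ∀ z, R.OnFace d z → R.OnFace d' z → z = a ∨ z = b := fun z hz hz' => by
        have hz1 : z ∈ (R.faceSubgraph d ⊓ R.faceSubgraph d').verts :=
          ⟨mem_verts_faceSubgraph.mpr hz, mem_verts_faceSubgraph.mpr hz'⟩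
        rw [h0] at hz1
        exact hz1
      obtain ⟨e, he, rfl, rfl⟩ := adj_faceSubgraph.mp hadj.1
      obtain ⟨e', he', h1, h2⟩ := adj_faceSubgraph.mp hadj.2
      obtain rfl : e' = e := SimpleGraph.Dart.eq_of_fst_of_snd h1 h2
      rcases he with he | he <;> rcases he' with he' | he'
      · exact absurd (he.trans he'.symm) hd
      · exact ⟨e', he, he', hverts⟩
      · exact ⟨e'.symm, he, by simpa using he', fun z hz hz' => (hverts z hz hz').symm⟩
      · exact absurd (he.trans he'.symm) hd

theorem isPolyhedral_iff [Finite V] : R.IsPolyhedral ↔ R.IsPolyhedralMap :=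
  ⟨IsPolyhedral.isPolyhedralMap, IsPolyhedralMap.isPolyhedral⟩

/-! ### Mirror images -/

theorem mirror_next (R : RotationSystem G) : R.mirror.next = R.next⁻¹ := rfl

theorem mirror_faceNext_symm (R : RotationSystem G) (d : G.Dart) :
    R.mirror.faceNext d.symm = (R.faceNext⁻¹ d).symm := by
  rw [faceNext_symm, mirror_next, faceNext_inv_apply, SimpleGraph.Dart.symm_symm]

theorem sameFace_mirror_symm [Finite V] {d e : G.Dart} (h : R.SameFace d e) :
    R.mirror.SameFace d.symm e.symm := by
  refine Equiv.Perm.SameCycle.induction (p := fun e => R.mirror.SameFace d.symm e.symm) h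
    (SameFace.refl _ _) fun z _ hz => hz.trans ?_
  have := R.mirror.sameFace_faceNext (R.faceNext z).symm
  rw [mirror_faceNext_symm] at this
  simpa using this.symm

theorem sameFace_mirror_iff [Finite V] {d e : G.Dart} :
    R.mirror.SameFace d e ↔ R.SameFace d.symm e.symm := by
  constructor
  · intro h
    have := sameFace_mirror_symm h
    rwa [mirror_mirror] at this
  · intro h
    simpa using sameFace_mirror_symm h

theorem onFace_mirror_iff [Finite V] {d : G.Dart} {x : V} :
    R.mirror.OnFace d x ↔ R.OnFace d.symm x := by
  constructor
  · rintro ⟨e, he, rfl⟩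
    exact (sameFace_mirror_iff.mp he).onFace_snd
  · rintro ⟨e, he, rfl⟩
    have : R.mirror.SameFace d e.symm := sameFace_mirror_iff.mpr (by simpa using he)
    exact this.onFace_snd

theorem IsPolyhedralMap.mirror [Finite V] (h : R.IsPolyhedralMap) : R.mirror.IsPolyhedralMap where
  connected := h.connected
  next_ne e he := h.next_ne e <| by
    rw [mirror_next, Equiv.Perm.inv_eq_iff_eq] at he
    exact he.symm
  simple d e hde hf := by
    rw [sameFace_mirror_iff] at hde
    have h1 : R.faceNext d.symm = R.faceNext e.symm :=
      h.simple ((SameFace.symm hde.symm.faceNext).faceNext) (by simpa [fst_faceNext] using hf)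
    simpa using congrArg SimpleGraph.Dart.symm (R.faceNext.injective h1)
  inter d d' hd x y hxy hx hx' hy hy' := by
    rw [onFace_mirror_iff] at hx hx' hy hy'
    rw [sameFace_mirror_iff] at hd
    obtain ⟨e, he, he', hz⟩ := h.inter hd hxy hx hx' hy hy'
    refine ⟨e.symm, sameFace_mirror_iff.mpr (by simpa using he),
      sameFace_mirror_iff.mpr (by simpa using he'), fun z hz1 hz2 => ?_⟩
    rw [onFace_mirror_iff] at hz1 hz2
    exact (hz z hz1 hz2).symm

theorem numFaces_mirror [Finite V] (R : RotationSystem G) : R.mirror.numFaces = R.numFaces := by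
  unfold numFaces
  congr 1
  refine Nat.card_congr (Quotient.congr
    (Function.Involutive.toPerm SimpleGraph.Dart.symm SimpleGraph.Dart.symm_involutive)
    fun d e => ?_)
  exact sameFace_mirror_iff

theorem HasGenus.mirror [Finite V] {g : ℕ} (h : R.HasGenus g) : R.mirror.HasGenus g := by
  unfold HasGenus at h ⊢
  rwa [numFaces_mirror]

end RotationSystem

/-! ### Homology modulo two of a spherical map -/

section Homology

open Module

variable {D : Type*}

/-- The functions with values in `ZMod 2` that are constant on the cycles of a permutation. -/
def Equiv.Perm.invariants (f : Equiv.Perm D) : Submodule (ZMod 2) (D → ZMod 2) where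
  carrier := {u | ∀ d, u (f d) = u d}
  add_mem' hu hv d := by simp [hu d, hv d]
  zero_mem' _ := rfl
  smul_mem' c u hu d := by simp [hu d]

theorem Equiv.Perm.SameCycle.invariants_eq [Finite D] {f : Equiv.Perm D} {u : D → ZMod 2}
    (hu : u ∈ f.invariants) {d e : D} (h : f.SameCycle d e) : u d = u e :=
  h.induction (p := fun e => u d = u e) (Eq.refl _) fun z _ hz => hz.trans (hu z).symm

variable [Fintype D]

/-- The number of cycles of a permutation is at most the dimension of the space of functions
constant on them. -/
theorem Equiv.Perm.card_cycles_le_finrank_invariants (f : Equiv.Perm D) :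
    Nat.card (Quotient (Equiv.Perm.SameCycle.setoid f)) ≤ finrank (ZMod 2) f.invariants := by
  have : Fintype (Quotient (Equiv.Perm.SameCycle.setoid f)) := Fintype.ofFinite _
  let q : D → Quotient (Equiv.Perm.SameCycle.setoid f) := Quotient.mk _
  have hq : ∀ u, LinearMap.funLeft (ZMod 2) (ZMod 2) q u ∈ f.invariants := fun u d => by
    have : q (f d) = q d := Quotient.sound ⟨-1, by simp⟩
    simp [LinearMap.funLeft, this]
  have h := LinearMap.finrank_le_finrank_of_injective
    (f := (LinearMap.funLeft (ZMod 2) (ZMod 2) q).codRestrict f.invariants hq)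
    (fun u v huv => LinearMap.funLeft_injective_of_surjective _ _ _ Quotient.mk_surjective
      (congrArg Subtype.val huv))
  rwa [Module.finrank_fintype_fun_eq_card, ← Nat.card_eq_fintype_card] at h

/-- The invariants of a fixed point free involution have at least half the full dimension. -/
theorem Equiv.Perm.card_le_two_mul_finrank_invariants (α : Equiv.Perm D) (hα : ∀ d, α (α d) = d) :
    Fintype.card D ≤ 2 * finrank (ZMod 2) α.invariants := by
  let T : (D → ZMod 2) →ₗ[ZMod 2] (D → ZMod 2) :=
    LinearMap.id + LinearMap.funLeft (ZMod 2) (ZMod 2) α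
  have hT : ∀ u d, T u d = u d + u (α d) := fun _ _ => rfl
  have hker : LinearMap.ker T ≤ α.invariants := fun u hu d => by
    have := congrFun (LinearMap.mem_ker.mp hu) d
    rw [hT] at this
    exact (CharTwo.add_eq_zero.mp this).symm
  have hrange : LinearMap.range T ≤ α.invariants := by
    rintro _ ⟨u, rfl⟩ d
    rw [hT, hT, hα, add_comm]
  have h := T.finrank_range_add_finrank_ker
  rw [Module.finrank_fintype_fun_eq_card] at h
  have h1 := Submodule.finrank_mono hker
  have h2 := Submodule.finrank_mono hrange
  omega

/-- Two functions invariant under a fixed point free involution are orthogonal modulo two. -/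
theorem Equiv.Perm.sum_mul_eq_zero_of_invariants (α : Equiv.Perm D) (hα : ∀ d, α (α d) = d)
    (hα' : ∀ d, α d ≠ d) {k l : D → ZMod 2} (hk : k ∈ α.invariants) (hl : l ∈ α.invariants) :
    ∑ d, k d * l d = 0 :=
  Finset.sum_involution (fun d _ => α d)
    (fun d _ => by rw [hk d, hl d]; exact CharTwo.add_self_eq_zero _)
    (fun d _ _ => hα' d) (fun _ _ => Finset.mem_univ _) (fun d _ => hα d)

/-- The first cohomology modulo two of a spherical map vanishes.  Let `σ` and `φ = σ ∘ α` be the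
vertex and face permutations of a connected map of genus zero.  A function on the edges whose
sum over each face is zero is the coboundary of a function on the vertices. -/
theorem exists_coboundary_of_sum_eq_zero (α σ φ : Equiv.Perm D) (hα : ∀ d, α (α d) = d)
    (hα' : ∀ d, α d ≠ d) (hφ : ∀ d, φ d = σ (α d))
    (hconn : ∀ u : D → ZMod 2, u ∈ σ.invariants → u ∈ α.invariants → ∀ d e, u d = u e)
    (heuler : Fintype.card D + 4 ≤
      2 * (Nat.card (Quotient (Equiv.Perm.SameCycle.setoid σ)) +
        Nat.card (Quotient (Equiv.Perm.SameCycle.setoid φ))))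
    (k : D → ZMod 2) (hk : k ∈ α.invariants) (hs : ∀ s ∈ φ.invariants, ∑ d, k d * s d = 0) :
    ∃ u ∈ σ.invariants, ∀ d, k d = u d + u (α d) := by
  let B : LinearMap.BilinForm (ZMod 2) (D → ZMod 2) := dotProductBilin (ZMod 2) (ZMod 2)
  have hB : ∀ u v, B u v = ∑ d, u d * v d := fun _ _ => rfl
  have hBker : B.ker = ⊥ := by
    rw [LinearMap.ker_eq_bot']
    intro u hu
    exact dotProduct_eq_zero u fun w => LinearMap.congr_fun hu w
  have hconst : ∀ W : Submodule (ZMod 2) (D → ZMod 2),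
      (∀ u ∈ W, ∀ d e, u d = u e) → finrank (ZMod 2) W ≤ 1 := fun W hW => by
    have hle : W ≤ Submodule.span (ZMod 2) {fun _ => 1} := fun u hu => by
      rw [Submodule.mem_span_singleton]
      rcases isEmpty_or_nonempty D with h | ⟨⟨d⟩⟩
      · exact ⟨0, funext fun d => h.elim d⟩
      · exact ⟨u d, funext fun e => by simp [hW u hu d e]⟩
    exact (Submodule.finrank_mono hle).trans ((finrank_span_le_card _).trans (by simp))
  -- The image of the coboundary operator has dimension at least `#vertices - 1`.
  let δ : σ.invariants →ₗ[ZMod 2] (D → ZMod 2) :=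
    (LinearMap.id + LinearMap.funLeft (ZMod 2) (ZMod 2) α).comp σ.invariants.subtype
  have hδ : ∀ u d, δ u d = u.1 d + u.1 (α d) := fun _ _ => rfl
  have hδker : finrank (ZMod 2) (LinearMap.ker δ) ≤ 1 := by
    rw [← Submodule.finrank_map_subtype_eq]
    refine hconst _ ?_
    rintro _ ⟨u, hu, rfl⟩
    refine hconn _ u.2 fun d => ?_
    have := congrFun (LinearMap.mem_ker.mp hu) d
    rw [hδ] at this
    exact (CharTwo.add_eq_zero.mp this).symm
  have hδrank := δ.finrank_range_add_finrank_ker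
  -- The image is contained in the space of all edge functions orthogonal to the faces.
  have hδle : LinearMap.range δ ≤ B.orthogonal (α.invariants ⊔ φ.invariants) := by
    rintro _ ⟨u, rfl⟩
    rw [LinearMap.BilinForm.mem_orthogonal_iff]
    intro w hw
    obtain ⟨l, hl, s, hs, rfl⟩ := Submodule.mem_sup.mp hw
    rw [map_add, LinearMap.add_apply, hB, hB]
    have h1 : ∑ d, l d * δ u d = 0 :=
      α.sum_mul_eq_zero_of_invariants hα hα' hl fun d => by rw [hδ, hδ, hα, add_comm]
    have h2 : ∑ d, s d * δ u d = 0 := by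
      have h3 : ∑ d, s d * u.1 (α d) = ∑ d, s d * u.1 d := by
        rw [← Equiv.sum_comp φ fun d => s d * u.1 d]
        exact Finset.sum_congr rfl fun d _ => by rw [hs d, hφ, u.2]
      simp only [hδ, mul_add, Finset.sum_add_distrib, h3]
      exact CharTwo.add_self_eq_zero _
    rw [h1, h2, add_zero]
  -- By Euler's formula the two spaces have the same dimension.
  have hinf : finrank (ZMod 2) (α.invariants ⊓ φ.invariants : Submodule _ _) ≤ 1 :=
    hconst _ fun u hu => hconn u (fun d => by
      have h1 := hu.2 (α d)
      rw [hφ, hα, hu.1 d] at h1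
      exact h1) hu.1
  have hsup := Submodule.finrank_sup_add_finrank_inf_eq α.invariants φ.invariants
  have horth := LinearMap.BilinForm.finrank_add_finrank_orthogonal' (B := B)
    (α.invariants ⊔ φ.invariants)
  rw [hBker, inf_bot_eq, finrank_bot, Module.finrank_fintype_fun_eq_card] at horth
  have h1 := α.card_le_two_mul_finrank_invariants hα
  have h2 := σ.card_cycles_le_finrank_invariants
  have h3 := φ.card_cycles_le_finrank_invariants
  have heq := Submodule.eq_of_le_of_finrank_le hδle (by omega)
  have hmem : k ∈ B.orthogonal (α.invariants ⊔ φ.invariants) := by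
    rw [LinearMap.BilinForm.mem_orthogonal_iff]
    intro w hw
    obtain ⟨l, hl, s, hs', rfl⟩ := Submodule.mem_sup.mp hw
    rw [map_add, LinearMap.add_apply, hB, hB,
      α.sum_mul_eq_zero_of_invariants hα hα' hl hk, zero_add, ← hs s hs']
    exact Finset.sum_congr rfl fun d _ => mul_comm _ _
  rw [← heq] at hmem
  obtain ⟨u, rfl⟩ := hmem
  exact ⟨u.1, u.2, hδ u⟩

end Homology

/-! ### Spherical embeddings of 3-connected graphs are polyhedral -/

theorem SimpleGraph.Reachable.induction {V : Type*} {G : SimpleGraph V} {x y : V}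
    (h : G.Reachable x y) {p : V → Prop} (hx : p x) (step : ∀ a b, G.Adj a b → p a → p b) :
    p y := by
  obtain ⟨w⟩ := h
  induction w with
  | nil => exact hx
  | cons hadj _ ih => exact ih (step _ _ hadj hx)

namespace RotationSystem

variable {V : Type*} {G : SimpleGraph V} {R : RotationSystem G}

/-- A property of directed edges that is preserved by the rotation and by reversal holds for all
directed edges of a connected graph as soon as it holds for one. -/
theorem dart_induction [Finite V] (R : RotationSystem G) (hG : G.Connected) {p : G.Dart → Prop}
    {d : G.Dart} (hd : p d) (hnext : ∀ e, p e → p (R.next e)) (hsymm : ∀ e, p e → p e.symm)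
    (e : G.Dart) : p e := by
  have hfst : ∀ e f : G.Dart, e.fst = f.fst → p e → p f := fun e f hef he =>
    (R.sameCycle e f hef).induction he fun z _ hz => hnext z hz
  refine (hG.preconnected d.fst e.fst).induction (p := fun x => ∀ e : G.Dart, e.fst = x → p e)
    (fun e he => hfst d e he.symm hd) (fun a b hab ha e he => ?_) e rfl
  exact hfst (SimpleGraph.Dart.mk (a, b) hab).symm e he.symm (hsymm _ (ha _ rfl))

theorem card_cycles_next [Finite V] (R : RotationSystem G) (hdeg : ∀ x, ∃ y, G.Adj x y) :
    Nat.card (Quotient (Equiv.Perm.SameCycle.setoid R.next)) = Nat.card V := by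
  refine Nat.card_congr (Equiv.ofBijective
    (Quotient.lift (fun d : G.Dart => d.fst) fun d e h => R.fst_eq_of_sameCycle h)
    ⟨?_, fun x => ?_⟩)
  · rintro ⟨d⟩ ⟨e⟩ h
    exact Quotient.sound (R.sameCycle d e h)
  · obtain ⟨y, hy⟩ := hdeg x
    exact ⟨Quotient.mk _ (SimpleGraph.Dart.mk (x, y) hy), rfl⟩

theorem _root_.SimpleGraph.card_dart_eq [Finite V] (G : SimpleGraph V) :
    Nat.card G.Dart = 2 * Nat.card G.edgeSet := by
  classical
  have : Fintype V := Fintype.ofFinite V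
  rw [Nat.card_eq_fintype_card, G.dart_card_eq_twice_card_edges, SimpleGraph.edgeFinset_card,
    Nat.card_eq_fintype_card]

theorem card_isolated (hdeg : ∀ x, ∃ y, G.Adj x y) : Nat.card {x : V // ∀ y, ¬ G.Adj x y} = 0 := by
  have : IsEmpty {x : V // ∀ y, ¬ G.Adj x y} :=
    ⟨fun x => let ⟨y, hy⟩ := hdeg x.1; x.2 y hy⟩
  exact Nat.card_of_isEmpty

/-- Euler's formula for a connected graph without isolated vertices. -/
theorem hasGenus_iff [Finite V] (hG : G.Connected) (hdeg : ∀ x, ∃ y, G.Adj x y) {g : ℕ} :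
    R.HasGenus g ↔
      Nat.card V + Nat.card (Quotient (Equiv.Perm.SameCycle.setoid R.faceNext)) + 2 * g =
        Nat.card G.edgeSet + 2 := by
  have hne := hG.nonempty
  have := hG.preconnected.subsingleton_connectedComponent
  have hc : Nat.card G.ConnectedComponent = 1 := by
    have : Nonempty G.ConnectedComponent := hne.map G.connectedComponentMk
    exact Nat.card_eq_one_iff_unique.mpr ⟨inferInstance, inferInstance⟩
  unfold HasGenus numFaces
  rw [card_isolated hdeg, hc]
  simp

/-- On a sphere, a function on the edges with sum zero over each face is a coboundary. -/
theorem exists_vertex_potential [Finite V] [Fintype G.Dart] (hG : G.Connected)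
    (hdeg : ∀ x, ∃ y, G.Adj x y) (hR : R.HasGenus 0) (k : G.Dart → ZMod 2)
    (hk : ∀ d, k d.symm = k d)
    (hs : ∀ s : G.Dart → ZMod 2, (∀ d, s (R.faceNext d) = s d) → ∑ d, k d * s d = 0) :
    ∃ U : V → ZMod 2, ∀ d, k d = U d.fst + U d.snd := by
  have he := (hasGenus_iff hG hdeg).mp hR
  have hd := G.card_dart_eq
  rw [Nat.card_eq_fintype_card] at hd
  obtain ⟨u, hu, huk⟩ := exists_coboundary_of_sum_eq_zero
    (Function.Involutive.toPerm SimpleGraph.Dart.symm SimpleGraph.Dart.symm_involutive)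
    R.next R.faceNext (fun d => d.symm_symm) (fun d => d.symm_ne) (fun _ => rfl)
    (fun u hu hu' d e => R.dart_induction hG (p := fun e => u d = u e) rfl
      (fun e h => h.trans (hu e).symm) (fun e h => h.trans (hu' e).symm) e)
    (by rw [R.card_cycles_next hdeg]; omega) k hk hs
  choose y hy using hdeg
  have hU : ∀ d : G.Dart, u (SimpleGraph.Dart.mk (d.fst, y d.fst) (hy d.fst)) = u d := fun d =>
    (R.sameCycle (SimpleGraph.Dart.mk (d.fst, y d.fst) (hy d.fst)) d rfl).invariants_eq hu
  refine ⟨fun x => u (SimpleGraph.Dart.mk (x, y x) (hy x)), fun d => ?_⟩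
  rw [huk]
  exact (congrArg₂ _ (hU d) (hU d.symm)).symm

/-- On a sphere, an edge set meeting every vertex evenly is the sum of the boundaries of
some faces: a weak form of the Jordan curve theorem. -/
theorem exists_face_potential [Finite V] [Fintype G.Dart] (hG : G.Connected)
    (hdeg : ∀ x, ∃ y, G.Adj x y) (hR : R.HasGenus 0) (k : G.Dart → ZMod 2)
    (hk : ∀ d, k d.symm = k d) (hU : ∀ U : V → ZMod 2, ∑ d, k d * U d.fst = 0) :
    ∃ s : G.Dart → ZMod 2, (∀ d, s (R.faceNext d) = s d) ∧ ∀ d, k d = s d + s d.symm := by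
  have he := (hasGenus_iff hG hdeg).mp hR
  have hd := G.card_dart_eq
  rw [Nat.card_eq_fintype_card] at hd
  choose y hy using hdeg
  obtain ⟨s, hs, hsk⟩ := exists_coboundary_of_sum_eq_zero
    (Function.Involutive.toPerm SimpleGraph.Dart.symm SimpleGraph.Dart.symm_involutive)
    R.faceNext R.next (fun d => d.symm_symm) (fun d => d.symm_ne)
    (fun d => (R.faceNext_symm d).symm)
    (fun u hu hu' d e => R.dart_induction hG (p := fun e => u d = u e) rfl
      (fun e h => by
        rw [← R.faceNext_symm, hu]
        exact h.trans (hu' e).symm) (fun e h => h.trans (hu' e).symm) e)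
    (by rw [R.card_cycles_next fun x => ⟨y x, hy x⟩]; omega) k hk
    (fun u hu => by
      rw [← hU fun x => u (SimpleGraph.Dart.mk (x, y x) (hy x))]
      refine Finset.sum_congr rfl fun d _ => ?_
      rw [(R.sameCycle d (SimpleGraph.Dart.mk (d.fst, y d.fst) (hy d.fst)) rfl).invariants_eq hu])
  exact ⟨s, hs, hsk⟩

end RotationSystem

namespace IsVertexConnected

variable {V : Type*} {G : SimpleGraph V}

theorem eq_of_forall_adj {k : ℕ} (h : IsVertexConnected G k) {α : Type*} (U : V → α) (S : Finset V)
    (hS : S.card < k) (hU : ∀ a b, a ∉ S → b ∉ S → G.Adj a b → U a = U b) {a b : V} (ha : a ∉ S)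
    (hb : b ∉ S) : U a = U b :=
  ((h.2 S hS).preconnected ⟨a, ha⟩ ⟨b, hb⟩).induction (p := fun y => U a = U y) rfl
    fun x y hxy hx => hx.trans (hU x y x.2 y.2 hxy)

theorem connected {k : ℕ} (h : IsVertexConnected G k) (hk : 0 < k) : G.Connected where
  preconnected x y := by
    have h1 := h.eq_of_forall_adj (fun y => G.Reachable x y) ∅ (by simpa using hk)
      (fun a b _ _ hab => propext
        ⟨fun h => h.trans hab.reachable, fun h => h.trans hab.symm.reachable⟩)
      (a := x) (b := y) (by simp) (by simp)
    exact h1 ▸ SimpleGraph.Reachable.refl x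
  nonempty := ⟨((h.2 ∅ (by simpa using hk)).nonempty.some).1⟩

/-- A vertex of a 3-connected graph has a third neighbour. -/
theorem exists_adj_ne_ne [Finite V] (h : IsVertexConnected G 3) (x y z : V) :
    ∃ w, G.Adj x w ∧ w ≠ y ∧ w ≠ z := by
  classical
  by_contra! hcon
  have : Fintype V := Fintype.ofFinite V
  obtain ⟨w, hw⟩ : ∃ w, w ∉ ({x, y, z} : Finset V) := by
    by_contra! hall
    have h1 : Nat.card V ≤ ({x, y, z} : Finset V).card := by
      rw [Nat.card_eq_fintype_card, ← Finset.card_univ]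
      exact Finset.card_le_card fun w _ => hall w
    have h2 : ({x, y, z} : Finset V).card ≤ 3 := Finset.card_le_three
    have := h.1
    omega
  simp only [Finset.mem_insert, Finset.mem_singleton, not_or] at hw
  have h3 := h.eq_of_forall_adj (fun w => w = x) (({y, z} : Finset V).erase x)
    (lt_of_le_of_lt (Finset.card_erase_le.trans Finset.card_le_two) (by norm_num))
    (fun a b ha hb hab => by
      have key : ∀ a b, b ∉ ({y, z} : Finset V).erase x → G.Adj a b → a ≠ x := by
        rintro a b hb hab rfl
        have h4 := hcon b hab
        have h5 := hab.ne'
        simp only [Finset.mem_erase, Finset.mem_insert, Finset.mem_singleton] at hb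
        tauto
      exact propext (iff_of_false (key a b hb hab) (key b a ha hab.symm)))
    (a := x) (b := w) (by simp) (by simp [hw])
  exact hw.1 (h3 ▸ rfl : w = x)

theorem exists_adj [Finite V] (h : IsVertexConnected G 3) (x : V) : ∃ y, G.Adj x y :=
  let ⟨w, hw, _⟩ := h.exists_adj_ne_ne x x x
  ⟨w, hw⟩

theorem next_next_ne [Finite V] (h : IsVertexConnected G 3) (R : RotationSystem G) (d : G.Dart) :
    R.next (R.next d) ≠ d := by
  intro hd
  obtain ⟨w, hw, h1, h2⟩ := h.exists_adj_ne_ne d.fst d.snd (R.next d).snd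
  have h3 := (R.sameCycle d (SimpleGraph.Dart.mk (d.fst, w) hw) rfl).induction
    (p := fun e => e = d ∨ e = R.next d) (Or.inl rfl) (by rintro z - (rfl | rfl) <;> simp [hd])
  rcases h3 with h3 | h3
  · exact h1 (congrArg (fun e : G.Dart => e.snd) h3)
  · exact h2 (congrArg (fun e : G.Dart => e.snd) h3)

theorem next_ne [Finite V] (h : IsVertexConnected G 3) (R : RotationSystem G) (d : G.Dart) :
    R.next d ≠ d := fun hd => h.next_next_ne R d (by rw [hd, hd])

end IsVertexConnected

/-- The indicator function `c` of the arc `a, f a, f² a, …` of a cycle, up to but not including `b`.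
Summation along the arc telescopes. -/
theorem Equiv.Perm.SameCycle.exists_arc {D : Type*} [Fintype D] {f : Equiv.Perm D} {a b : D}
    (h : f.SameCycle a b) (hab : a ≠ b) :
    ∃ c : D → ZMod 2, c a = 1 ∧ c b = 0 ∧ (f a ≠ b → c (f a) = 1) ∧
      (∀ d, ¬ f.SameCycle a d → c d = 0) ∧
      ∀ s : D → ZMod 2, ∑ d, c d * (s d + s (f d)) = s a + s b := by
  classical
  have hex := h.exists_nat_pow_eq
  set n := Nat.find hex with hn
  have hnb : (f ^ n) a = b := Nat.find_spec hex
  have hmin : ∀ i < n, (f ^ i) a ≠ b := fun i hi => Nat.find_min hex hi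
  have hn0 : 0 < n := Nat.pos_of_ne_zero fun h0 => hab (by simpa [h0] using hnb)
  have hinj : Set.InjOn (fun i => (f ^ i) a) (Finset.range n : Set ℕ) := by
    have key : ∀ i j, i < j → j < n → (f ^ i) a ≠ (f ^ j) a := fun i j hij hj he => by
      refine hmin (n - j + i) (by omega) ?_
      rw [pow_add, Equiv.Perm.mul_apply, he, ← Equiv.Perm.mul_apply, ← pow_add,
        Nat.sub_add_cancel hj.le, hnb]
    intro i hi j hj he
    rw [Finset.coe_range, Set.mem_Iio] at hi hj
    rcases lt_trichotomy i j with hlt | rfl | hlt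
    · exact absurd he (key i j hlt hj)
    · rfl
    · exact absurd he.symm (key j i hlt hi)
  refine ⟨fun d => if ∃ i < n, (f ^ i) a = d then 1 else 0, if_pos ⟨0, hn0, Eq.refl _⟩,
    if_neg fun ⟨i, hi, he⟩ => hmin i hi he, fun hfa => ?_,
    fun d hd => if_neg fun ⟨i, _, he⟩ => hd ⟨i, by simpa using he⟩, fun s => ?_⟩
  · refine if_pos ⟨1, ?_, by simp⟩
    by_contra h1
    have : n = 1 := by omega
    exact hfa (by simpa [this] using hnb)
  · have h1 : ∑ d, (if ∃ i < n, (f ^ i) a = d then (1 : ZMod 2) else 0) * (s d + s (f d)) =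
        ∑ i ∈ Finset.range n, (s ((f ^ i) a) + s ((f ^ (i + 1)) a)) := by
      simp only [ite_mul, one_mul, zero_mul, ← Finset.sum_filter]
      have h2 : Finset.univ.filter (fun d => ∃ i < n, (f ^ i) a = d) =
          (Finset.range n).image fun i => (f ^ i) a := by
        ext d
        simp
      rw [h2, Finset.sum_image hinj]
      simp only [pow_succ', Equiv.Perm.mul_apply]
    rw [h1, ← hnb]
    clear_value n
    clear h1 hinj hmin hnb hn0 hn
    induction n with
    | zero => simp [CharTwo.add_self_eq_zero]
    | succ n ih =>
      rw [Finset.sum_range_succ, ih, add_assoc, ← add_assoc (s ((f ^ n) a)),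
        CharTwo.add_self_eq_zero, zero_add]

namespace RotationSystem

variable {V : Type*} {G : SimpleGraph V} {R : RotationSystem G}

theorem exists_vertex_potential_of_arcs [Finite V] [Fintype G.Dart] (hG : G.Connected)
    (hdeg : ∀ x, ∃ y, G.Adj x y) (hR : R.HasGenus 0) (c : G.Dart → ZMod 2)
    (hs : ∀ s : G.Dart → ZMod 2, (∀ d e, R.SameFace d e → s d = s e) →
      ∑ d, c d * (s d + s (R.next d)) = 0) :
    ∃ U : V → ZMod 2, ∀ d, c d + c d.symm = U d.fst + U d.snd := by
  refine exists_vertex_potential hG hdeg hR (fun d => c d + c d.symm)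
    (fun d => by rw [SimpleGraph.Dart.symm_symm, add_comm]) fun s hs' => ?_
  rw [← hs s fun d e hde => Equiv.Perm.SameCycle.invariants_eq hs' hde]
  have h1 : ∑ d, c d.symm * s d = ∑ d, c d * s d.symm := by
    rw [← Equiv.sum_comp
      (Function.Involutive.toPerm SimpleGraph.Dart.symm SimpleGraph.Dart.symm_involutive)]
    exact Finset.sum_congr rfl fun d _ => by
      simp only [Function.Involutive.coe_toPerm, SimpleGraph.Dart.symm_symm]
  simp only [add_mul, mul_add, Finset.sum_add_distrib, h1]
  congr 1
  exact Finset.sum_congr rfl fun d _ => by rw [← hs' d.symm, faceNext_symm]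

/-- A facial walk of a spherical embedding passes only once through a vertex that is not a cut
vertex: otherwise the edges at this vertex between the two passages form a cut. -/
theorem simple_of_isVertexConnected [Finite V] (h : IsVertexConnected G 3) (hR : R.HasGenus 0)
    {d e : G.Dart} (hde : R.SameFace d e) (hf : d.fst = e.fst) : d = e := by
  classical
  have : Fintype G.Dart := Fintype.ofFinite _
  by_contra hne
  obtain ⟨c, hc1, hc0, -, hcx, hcs⟩ := (R.sameCycle d e hf).exists_arc hne
  replace hcx : ∀ f : G.Dart, f.fst ≠ d.fst → c f = 0 := fun f hf =>
    hcx f fun h' => hf (R.fst_eq_of_sameCycle h').symm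
  obtain ⟨U, hU⟩ := exists_vertex_potential_of_arcs (h.connected (by norm_num)) h.exists_adj hR c
    fun s hs => by rw [hcs, hs d e hde]; exact CharTwo.add_self_eq_zero _
  have hconst : U d.snd = U e.snd :=
    h.eq_of_forall_adj U {d.fst} (by simp) (fun a b ha hb hab => by
      rw [Finset.mem_singleton] at ha hb
      have h1 := hU (SimpleGraph.Dart.mk (a, b) hab)
      rw [hcx _ ha, hcx _ hb, add_zero] at h1
      exact CharTwo.add_eq_zero.mp h1.symm)
      (by simp) (by simp [hf])
  have h1 := hU d
  have h2 := hU e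
  rw [hc1, hcx _ d.snd_ne_fst, hconst, hf] at h1
  rw [hc0, hcx _ (by rw [hf]; exact e.snd_ne_fst), ← h1] at h2
  simp at h2

/-- Let two faces of a spherical embedding of a 3-connected graph share the vertices `x` and `y`,
and let `d` and `d'` be the directed edges of the two faces starting at `x`.  As the edges that
lie between the two faces at `x` and at `y` form a cut, one of `d`, `d'` ends in `y`, and it is
followed by the other one in the rotation at `x`. -/
theorem next_eq_of_common_vertices [Finite V] (h : IsVertexConnected G 3) (hR : R.HasGenus 0)
    {d d' f f' : G.Dart} (hd : ¬ R.SameFace d d') (hdf : R.SameFace d f) (hdf' : R.SameFace d' f')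
    (hx : d.fst = d'.fst) (hy : f.fst = f'.fst) (hxy : d.fst ≠ f.fst) :
    d.snd = f.fst ∧ R.next d = d' ∨ d'.snd = f.fst ∧ R.next d' = d := by
  classical
  have : Fintype G.Dart := Fintype.ofFinite _
  -- By symmetry, the rotation has to be found only in the case that `d` ends in `y`.
  have key : ∀ {d d' f f' : G.Dart}, ¬ R.SameFace d d' → R.SameFace d f → R.SameFace d' f' →
      d.fst = d'.fst → f.fst = f'.fst → d.fst ≠ f.fst →
      (d.snd = f.fst → R.next d = d') ∧ (d.snd = f.fst ∨ d'.snd = f.fst) := by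
    clear hd hdf hdf' hx hy hxy d d' f f'
    intro d d' f f' hd hdf hdf' hx hy hxy
    have hdd : d ≠ d' := by
      rintro rfl
      exact hd (SameFace.refl _ _)
    have hff : f ≠ f' := by
      rintro rfl
      exact hd (hdf.trans hdf'.symm)
    obtain ⟨c, hc1, hc0, hcn, hcx, hcs⟩ := (R.sameCycle d d' hx).exists_arc hdd
    obtain ⟨b, -, -, -, hbx, hbs⟩ := (R.sameCycle f f' hy).exists_arc hff
    replace hcx : ∀ e : G.Dart, e.fst ≠ d.fst → c e = 0 := fun e he =>
      hcx e fun h' => he (R.fst_eq_of_sameCycle h').symm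
    replace hbx : ∀ e : G.Dart, e.fst ≠ f.fst → b e = 0 := fun e he =>
      hbx e fun h' => he (R.fst_eq_of_sameCycle h').symm
    obtain ⟨U, hU⟩ := exists_vertex_potential_of_arcs (h.connected (by norm_num)) h.exists_adj hR
      (fun e => c e + b e) fun s hs => by
        simp only [add_mul, Finset.sum_add_distrib]
        rw [hcs, hbs, hs d f hdf, hs d' f' hdf']
        exact CharTwo.add_self_eq_zero _
    have hconst : ∀ a b', a ∉ ({d.fst, f.fst} : Finset V) → b' ∉ ({d.fst, f.fst} : Finset V) →
        U a = U b' := fun a b' ha hb =>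
      h.eq_of_forall_adj U {d.fst, f.fst} (lt_of_le_of_lt Finset.card_le_two (by norm_num))
        (fun a b' ha hb hab => by
          simp only [Finset.mem_insert, Finset.mem_singleton, not_or] at ha hb
          have h1 := hU (SimpleGraph.Dart.mk (a, b') hab)
          dsimp only at h1
          rw [hcx _ ha.1, hbx _ ha.2, hcx _ hb.1, hbx _ hb.2] at h1
          exact CharTwo.add_eq_zero.mp (by simpa using h1.symm)) ha hb
    -- The arc at `x` contains all or none of the edges that do not end in `y`.
    have hc : ∀ e e' : G.Dart, e.fst = d.fst → e'.fst = d.fst → e.snd ≠ f.fst → e'.snd ≠ f.fst →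
        c e = c e' := by
      have hce : ∀ e : G.Dart, e.fst = d.fst → e.snd ≠ f.fst → c e = U d.fst + U e.snd :=
        fun e he he' => by
          have h1 := hU e
          have h2 : e.snd ≠ d.fst := by rw [← he]; exact e.snd_ne_fst
          rw [hbx e (by rw [he]; exact hxy), hcx e.symm h2, hbx e.symm he', he] at h1
          simpa using h1
      intro e e' he he' hs hs'
      have h2 : e.snd ≠ d.fst := by rw [← he]; exact e.snd_ne_fst
      have h3 : e'.snd ≠ d.fst := by rw [← he']; exact e'.snd_ne_fst
      rw [hce e he hs, hce e' he' hs', hconst e.snd e'.snd (by simp [h2, hs]) (by simp [h3, hs'])]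
    constructor
    · intro hds
      by_contra hn
      have hne := h.next_ne R d
      have hs : ∀ e : G.Dart, e.fst = d.fst → e ≠ d → e.snd ≠ f.fst := fun e he hed hes =>
        hed (SimpleGraph.Dart.eq_of_fst_of_snd he (hes.trans hds.symm))
      have h1 := hc (R.next d) d' (R.next_fst d) hx.symm (hs _ (R.next_fst d) hne)
        (hs _ hx.symm hdd.symm)
      rw [hcn hn, hc0] at h1
      exact one_ne_zero h1
    · by_contra! hcon
      have h1 := hc d d' rfl hx.symm hcon.1 hcon.2
      rw [hc1, hc0] at h1
      exact one_ne_zero h1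
  have h1 := key hd hdf hdf' hx hy hxy
  have h2 := key (fun h' => hd h'.symm) hdf' hdf hx.symm hy.symm (by rw [← hx, ← hy]; exact hxy)
  rw [← hy] at h2
  rcases h1.2 with h3 | h3
  · exact Or.inl ⟨h3, h1.1 h3⟩
  · exact Or.inr ⟨h3, h2.1 h3⟩

/-- An embedding of genus zero of a 3-connected graph is polyhedral. -/
theorem isPolyhedralMap_of_isVertexConnected [Finite V] (h : IsVertexConnected G 3)
    (hR : R.HasGenus 0) : R.IsPolyhedralMap where
  connected := h.connected (by norm_num)
  next_ne := h.next_ne R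
  simple _ _ := simple_of_isVertexConnected h hR
  inter := by
    rintro d₀ d₀' hd x y hxy ⟨d, hd₀, rfl⟩ ⟨d', hd₀', hx⟩ ⟨f, hf, rfl⟩ ⟨f', hf', hy⟩
    have hdd : ¬ R.SameFace d d' := fun h' => hd ((hd₀.trans h').trans hd₀'.symm)
    have key : ∀ z, z ≠ d.fst → R.OnFace d₀ z → R.OnFace d₀' z →
        d.snd = z ∧ R.next d = d' ∨ d'.snd = z ∧ R.next d' = d := by
      rintro _ hz ⟨g, hg, rfl⟩ ⟨g', hg', hgg⟩
      exact next_eq_of_common_vertices h hR hdd (hd₀.symm.trans hg) (hd₀'.symm.trans hg')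
        hx.symm hgg.symm hz.symm
    have hnot : R.next d = d' → R.next d' = d → False := fun h1 h2 =>
      h.next_next_ne R d (by rw [h1, h2])
    rcases key f.fst hxy.symm hf.onFace_fst (hy ▸ hf'.onFace_fst) with ⟨h1, h2⟩ | ⟨h1, h2⟩
    · refine ⟨d, hd₀, hd₀'.trans (SameFace.symm (h2 ▸ R.sameFace_symm_next d)), fun z hz hz' => ?_⟩
      by_cases hzd : z = d.fst
      · exact Or.inl hzd
      · rcases key z hzd hz hz' with ⟨h3, -⟩ | ⟨-, h3⟩
        · exact Or.inr h3.symm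
        · exact (hnot h2 h3).elim
    · refine ⟨d'.symm, hd₀.trans (SameFace.symm (h2 ▸ R.sameFace_symm_next d')),
        by simpa using hd₀', fun z hz hz' => ?_⟩
      by_cases hzd : z = d.fst
      · exact Or.inr (hzd.trans hx.symm)
      · rcases key z hzd hz hz' with ⟨-, h3⟩ | ⟨h3, -⟩
        · exact (hnot h3 h2).elim
        · exact Or.inl h3.symm

end RotationSystem

/-! ### A polyhedral embedding of a planar graph is spherical and unique -/

namespace RotationSystem

variable {V : Type*} {G : SimpleGraph V} {R P : RotationSystem G}

theorem snd_faceNext_inv (R : RotationSystem G) (d : G.Dart) : (R.faceNext⁻¹ d).snd = d.fst := by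
  rw [← R.fst_faceNext]
  simp

/-- The edge of `f` does not lie on the face of `d`. -/
def OffFace (R : RotationSystem G) (d f : G.Dart) : Prop :=
  ¬ R.SameFace d f ∧ ¬ R.SameFace d f.symm

theorem OffFace.symm {d f : G.Dart} (h : R.OffFace d f) : R.OffFace d f.symm :=
  ⟨h.2, by simpa using h.1⟩

theorem offFace_of_not_onFace {d f : G.Dart} (h : ¬ R.OnFace d f.fst) : R.OffFace d f :=
  ⟨fun h' => h h'.onFace_fst, fun h' => h h'.onFace_snd⟩

namespace IsPolyhedralMap

/-- A face does not share two consecutive edges with another face. -/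
theorem not_sameFace_symm_faceNext (h : R.IsPolyhedralMap) {d g : G.Dart} (hg : ¬ R.SameFace d g)
    (hg' : R.SameFace d g.symm) : ¬ R.SameFace d (R.faceNext g).symm := by
  intro hn
  have h0 := SameFace.refl R g
  obtain ⟨e, -, -, hz⟩ := h.inter hg g.fst_ne_snd hg'.onFace_snd h0.onFace_fst hg'.onFace_fst
    h0.onFace_snd
  have h1 := hz g.fst hg'.onFace_snd h0.onFace_fst
  have h2 := hz g.snd hg'.onFace_fst h0.onFace_snd
  have h3 := hz (R.faceNext g).snd hn.onFace_fst h0.faceNext.onFace_snd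
  have h4 := h.snd_faceNext_ne g
  have h5 := g.fst_ne_snd
  have h6 := (R.faceNext g).snd_ne_fst
  rw [R.fst_faceNext] at h6
  rcases h1 with h1 | h1 <;> rcases h2 with h2 | h2 <;> rcases h3 with h3 | h3 <;> simp_all

/-- The two edges of a facial cycle at one of its vertices. -/
theorem eq_or_eq_of_not_offFace (h : R.IsPolyhedralMap) {d e f : G.Dart} (he : R.SameFace d e)
    (hf : f.fst = e.snd) (hn : ¬ R.OffFace d f) : f = R.faceNext e ∨ f = e.symm := by
  have hfe := R.fst_faceNext e
  by_cases h1 : R.SameFace d f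
  · exact Or.inl (h.simple (h1.symm.trans he.faceNext) (hf.trans hfe.symm))
  · have h2 : R.SameFace d f.symm := by
      by_contra h2
      exact hn ⟨h1, h2⟩
    right
    have h3 : R.faceNext f.symm = R.faceNext e :=
      h.simple (h2.faceNext.symm.trans he.faceNext)
        ((R.fst_faceNext f.symm).trans (hf.trans hfe.symm))
    rw [← R.faceNext.injective h3, SimpleGraph.Dart.symm_symm]

/-- A facial cycle of a polyhedral embedding is induced and non-separating.  Let `s` be a function
on the directed edges that is constant on the faces of an embedding `P` and that
takes the same value on both sides of each edge off the face of `d`.  Then `s` is constant off the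
face of `d`. -/
theorem exists_forall_offFace_eq [Finite V] (h : R.IsPolyhedralMap) (d : G.Dart) {α : Type*}
    (s : G.Dart → α) (hs : ∀ f, s (P.faceNext f) = s f)
    (hs' : ∀ f, R.OffFace d f → s f.symm = s f) : ∃ t, ∀ f, R.OffFace d f → s f = t := by
  have hrot : ∀ e f : G.Dart, e.fst = f.fst → ¬ R.OnFace d e.fst → s e = s f := by
    intro e f hef he
    refine (P.sameCycle e f hef).induction (p := fun f => s e = s f) rfl fun z hz hz' => ?_
    rw [hz', ← P.faceNext_symm, hs, hs']
    exact offFace_of_not_onFace (P.fst_eq_of_sameCycle hz ▸ he)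
  have hstep : ∀ f, ¬ R.OnFace d f.snd → s (R.faceNext f) = s f := by
    intro f hf
    have hoff : R.OffFace d f.symm := offFace_of_not_onFace hf
    rw [hrot (R.faceNext f) f.symm (R.fst_faceNext f) (by rwa [R.fst_faceNext])]
    simpa using (hs' _ hoff).symm
  -- Any other face has at most one edge leaving the face of `d`.
  have huniq : ∀ f g, ¬ R.SameFace d f → R.SameFace f g → R.OffFace d f → R.OffFace d g →
      R.OnFace d f.fst → R.OnFace d g.fst → f = g := by
    intro f g hf hfg hof hog hcf hcg
    by_cases hne : f.fst = g.fst
    · exact h.simple hfg hne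
    exfalso
    obtain ⟨e, he, he', hz⟩ := h.inter hf hne hcf (SameFace.refl R f).onFace_fst hcg
      hfg.onFace_fst
    have key : ∀ f', R.SameFace f f' → R.OffFace d f' → f'.fst = e.snd → False := by
      intro f' hf' ho hfe
      have : f' = e.symm := h.simple (hf'.symm.trans he') hfe
      rw [this] at ho
      exact ho.2 (by simpa using he)
    rcases hz _ hcf (SameFace.refl R f).onFace_fst with h1 | h1
    · rcases hz _ hcg hfg.onFace_fst with h2 | h2
      · exact hne (h1.trans h2.symm)
      · exact key g hfg hog h2
    · exact key f (SameFace.refl R f) hof h1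
  -- Hence `s` is constant on the edges of another face that are off the face of `d`.
  have hface : ∀ f g, R.SameFace f g → R.OffFace d f → R.OffFace d g → s f = s g := by
    intro f g hfg hf hg
    by_cases hex : ∃ e, R.SameFace f e ∧ R.OffFace d e ∧ R.OnFace d e.fst
    · obtain ⟨e, hfe, he, hce⟩ := hex
      have key : ∀ z, R.SameFace e z → R.OffFace d z → s z = s e := by
        intro z hz
        refine hz.induction (p := fun z => R.OffFace d z → s z = s e) (fun _ => rfl) ?_
        intro z hz ih hoz
        by_cases hcz : R.OnFace d (R.faceNext z).fst
        · rw [← huniq e _ he.1 (SameFace.faceNext hz) he hoz hce hcz]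
        · rw [R.fst_faceNext] at hcz
          have hz' := (offFace_of_not_onFace (f := z.symm) hcz).symm
          rw [SimpleGraph.Dart.symm_symm] at hz'
          rw [hstep z hcz, ih hz']
      rw [key f hfe.symm hf, key g (hfe.symm.trans hfg) hg]
    · push Not at hex
      have key : R.OffFace d g ∧ s f = s g := by
        refine hfg.induction (p := fun g => R.OffFace d g ∧ s f = s g) ⟨hf, rfl⟩ ?_
        rintro z hz ⟨ho, hsz⟩
        have hz1 : R.SameFace f (R.faceNext z) := SameFace.faceNext hz
        have hnot : ∀ z, R.SameFace f z → ¬ R.SameFace d z := fun z hz h' =>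
          hf.1 (h'.trans hz.symm)
        have hcz : ¬ R.OnFace d (R.faceNext z).fst := by
          intro hcz
          have h1 : R.SameFace d (R.faceNext z).symm := by
            by_contra h1
            exact hex _ hz1 ⟨hnot _ hz1, h1⟩ hcz
          refine h.not_sameFace_symm_faceNext (hnot _ hz1) h1 ?_
          by_contra h2
          exact hex _ hz1.faceNext ⟨hnot _ hz1.faceNext, h2⟩
            (by rw [R.fst_faceNext]; exact h1.onFace_fst)
        refine ⟨offFace_of_not_onFace hcz, ?_⟩
        rw [R.fst_faceNext] at hcz
        rw [hstep z hcz, hsz]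
      exact key.2
  -- At a vertex of the face of `d`, any two neighbouring edges off this face share another face.
  have hvert : ∀ e f g, R.SameFace d e → R.OffFace d f → R.OffFace d g → f.fst = e.snd →
      g.fst = e.snd → s f = s g := by
    intro e f g he hf hg hfe hge
    have key : ∀ f : G.Dart, f.fst = e.snd → R.OffFace d f →
        s f = s (R.next (R.faceNext e)) := by
      intro f hfe
      refine (R.sameCycle (R.faceNext e) f ((R.fst_faceNext e).trans hfe.symm)).induction
        (p := fun f => R.OffFace d f → s f = s (R.next (R.faceNext e)))
        (fun ho => absurd he.faceNext ho.1) fun z hz ih hoz => ?_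
      by_cases ho : R.OffFace d z
      · rw [← ih ho, ← hs' z ho]
        exact (hface _ _ (R.sameFace_symm_next z) ho.symm hoz).symm
      · have hze : z.fst = e.snd := (R.fst_eq_of_sameCycle hz).symm.trans (R.fst_faceNext e)
        rcases h.eq_or_eq_of_not_offFace he hze ho with rfl | rfl
        · rfl
        · exact absurd he.faceNext hoz.1
    rw [key f hfe hf, key g hge hg]
  -- Adjacent vertices of the face of `d` are joined along the second face at their common edge.
  have hcycle : ∀ e, R.SameFace d e → ∀ f, R.OffFace d f → f.fst = e.snd →
      s f = s (R.next (R.faceNext d)) := by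
    intro e he
    refine he.induction (p := fun e => ∀ f, R.OffFace d f → f.fst = e.snd →
      s f = s (R.next (R.faceNext d))) (fun f hf hfd => ?_) fun z hz ih f hf hfz => ?_
    all_goals
      have key : ∀ g, R.SameFace d g → R.OffFace d (R.next g) := by
        intro g hg
        have hg' : ¬ R.SameFace d g.symm := fun hg' => h.not_sameFace_symm g (hg.symm.trans hg')
        refine ⟨fun h' => hg' (h'.trans (SameFace.symm (R.sameFace_symm_next g))), ?_⟩
        have := h.not_sameFace_symm_faceNext hg' (by simpa using hg)
        rwa [R.faceNext_symm] at this
    · exact hvert d f _ (SameFace.refl R d) hf (key _ (SameFace.refl R d).faceNext) hfd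
        ((R.next_fst _).trans (R.fst_faceNext d))
    · replace hz : R.SameFace d z := hz
      have hg := hz.faceNext
      set g := R.faceNext z with hgz
      have ha := key g hg
      have hb : R.OffFace d (R.faceNext⁻¹ g.symm) := by
        have hg' : ¬ R.SameFace d g.symm := fun hg' => h.not_sameFace_symm g (hg.symm.trans hg')
        have hb1 : ¬ R.SameFace d (R.faceNext⁻¹ g.symm) := fun h' => hg' (by
          simpa using h'.faceNext)
        refine ⟨hb1, fun hb2 => h.not_sameFace_symm_faceNext hb1 hb2 (by simpa using hg)⟩
      have hab : s (R.next g) = s (R.faceNext⁻¹ g.symm) :=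
        hface _ _ ((R.sameFace_symm_next g).symm.trans (SameFace.refl R g.symm).faceNext_inv) ha hb
      rw [← ih _ ha ((R.next_fst g).trans (by rw [hgz, R.fst_faceNext])), hab, ← hs' _ hb]
      refine hvert g _ _ hg hf hb.symm hfz ?_
      rw [R.faceNext_inv_apply, SimpleGraph.Dart.symm_symm, R.next_inv_fst]
      rfl
  refine ⟨s (R.next (R.faceNext d)), fun f hf => ?_⟩
  refine (h.connected.preconnected d.snd f.fst).induction
    (p := fun x => ∀ f, R.OffFace d f → f.fst = x → s f = s (R.next (R.faceNext d)))
    (fun f hf hfd => hcycle d (SameFace.refl R d) f hf hfd) (fun a b hab ha f hf hfb => ?_) f hf rfl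
  by_cases hb : R.OnFace d b
  · obtain ⟨e, he, rfl⟩ := hb
    exact hcycle _ he.faceNext_inv f hf (hfb.trans (R.snd_faceNext_inv e).symm)
  · have hoff : R.OffFace d (SimpleGraph.Dart.mk (a, b) hab).symm := offFace_of_not_onFace hb
    rw [hrot f (SimpleGraph.Dart.mk (a, b) hab).symm hfb (hfb ▸ hb), ← hs' _ hoff]
    exact ha _ hoff.symm rfl

/-- A facial cycle of a polyhedral embedding of a planar graph is a facial cycle of every spherical
embedding: by the Jordan curve theorem it separates the sphere, and one of the two sides contains
no edges as the cycle is induced and non-separating. -/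
theorem faceNext_eq_or_of_hasGenus_zero [Finite V] (h : R.IsPolyhedralMap) (hP : P.HasGenus 0)
    (hdeg : ∀ x, ∃ y, G.Adj x y) (d : G.Dart) :
    (∀ e, R.SameFace d e → P.faceNext e = R.faceNext e) ∨
      ∀ e, R.SameFace d e → P.faceNext e.symm = (R.faceNext⁻¹ e).symm := by
  classical
  have : Fintype G.Dart := Fintype.ofFinite _
  let c : G.Dart → ZMod 2 := fun e => if R.SameFace d e then 1 else 0
  have hc : ∀ e, c (R.faceNext e) = c e := fun e =>
    if_congr ⟨fun h' => by simpa using h'.faceNext_inv, fun h' => h'.faceNext⟩ rfl rfl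
  have hsum : ∀ U : V → ZMod 2, ∑ e, (c e + c e.symm) * U e.fst = 0 := by
    intro U
    have h1 : ∑ e : G.Dart, c e.symm * U e.fst = ∑ e, c e * U e.snd := by
      rw [← Equiv.sum_comp
        (Function.Involutive.toPerm SimpleGraph.Dart.symm SimpleGraph.Dart.symm_involutive)]
      refine Finset.sum_congr rfl fun e _ => ?_
      simp only [Function.Involutive.coe_toPerm, SimpleGraph.Dart.symm_symm]
      rfl
    have h2 : ∑ e, c e * U e.snd = ∑ e, c e * U e.fst := by
      rw [← Equiv.sum_comp R.faceNext fun e => c e * U e.fst]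
      exact Finset.sum_congr rfl fun e _ => by simp only [hc, R.fst_faceNext]
    simp only [add_mul, Finset.sum_add_distrib]
    rw [h1, h2]
    exact CharTwo.add_self_eq_zero _
  obtain ⟨s, hs, hsc⟩ := exists_face_potential h.connected hdeg hP (fun e => c e + c e.symm)
    (fun e => by rw [SimpleGraph.Dart.symm_symm, add_comm]) hsum
  have hon : ∀ e, R.SameFace d e → s e ≠ s e.symm := by
    intro e he hse
    have h1 := hsc e
    have h2 : ¬ R.SameFace d e.symm := fun h' => h.not_sameFace_symm e (he.symm.trans h')
    simp only [c, if_pos he, if_neg h2, hse, CharTwo.add_self_eq_zero] at h1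
    simp at h1
  obtain ⟨t, ht⟩ := h.exists_forall_offFace_eq d s hs fun e he => by
    have h1 := hsc e
    simp only [c, if_neg he.1, if_neg he.2, add_zero] at h1
    exact (CharTwo.add_eq_zero.mp h1.symm).symm
  have hnot : ∀ e, s e ≠ t → ¬ R.OffFace d e := fun e he ho => he (ht e ho)
  by_cases hex : ∃ e, R.SameFace d e ∧ s e ≠ t
  · left
    have hstep : ∀ e, R.SameFace d e → s e ≠ t → P.faceNext e = R.faceNext e := by
      intro e he hse
      rcases h.eq_or_eq_of_not_offFace he (P.fst_faceNext e) (hnot _ (by rwa [hs])) with h1 | h1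
      · exact h1
      · exact absurd (by rw [← h1, hs]) (hon e he)
    obtain ⟨e, he, hse⟩ := hex
    intro f hf
    refine hstep f hf ?_
    refine Equiv.Perm.SameCycle.induction (p := fun f => s f ≠ t)
      (SameFace.trans he.symm hf) hse fun z hz hsz => ?_
    rwa [← hstep z (he.trans hz) hsz, hs]
  · right
    push Not at hex
    intro e he
    have h1 : s e.symm ≠ t := fun h1 => hon e he ((hex e he).trans h1.symm)
    rcases h.eq_or_eq_of_not_offFace he.faceNext_inv (f := P.faceNext e.symm)
      ((P.fst_faceNext e.symm).trans (R.snd_faceNext_inv e).symm) (hnot _ (by rwa [hs]))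
      with h2 | h2
    · refine absurd ?_ (hon e he)
      rw [← hs e.symm, h2]
      simp
    · exact h2

/-- Whitney's theorem for polyhedral embeddings: if a graph has a spherical embedding `P`, then
its polyhedral embeddings, on whatever surface, agree with `P` up to reflection. -/
theorem eq_or_eq_mirror_of_hasGenus_zero [Finite V] (h : R.IsPolyhedralMap) (hP : P.HasGenus 0)
    (hdeg : ∀ x, ∃ y, G.Adj x y) : R = P ∨ R = P.mirror := by
  have hA : ∀ d, (∀ e, R.SameFace d e → P.faceNext e = R.faceNext e) →
      ∀ e, R.SameFace d.symm e → P.faceNext e = R.faceNext e := by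
    intro d hd
    refine (h.faceNext_eq_or_of_hasGenus_zero hP hdeg d.symm).resolve_right fun hB => ?_
    have h1 := hB d.symm (SameFace.refl R _)
    rw [SimpleGraph.Dart.symm_symm, hd d (SameFace.refl R d)] at h1
    refine h.not_sameFace_symm_faceNext (d := d.symm) (g := d)
      (fun h' => h.not_sameFace_symm d h'.symm) (SameFace.refl R _) ?_
    rw [h1, SimpleGraph.Dart.symm_symm]
    exact (SameFace.refl R _).faceNext_inv
  by_cases hex : ∃ d, ∀ e, R.SameFace d e → P.faceNext e = R.faceNext e
  · obtain ⟨d, hd⟩ := hex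
    left
    ext1
    have hall := R.dart_induction h.connected
      (p := fun d => ∀ e, R.SameFace d e → P.faceNext e = R.faceNext e) hd
      (fun f hf e he => hA f hf e ((R.sameFace_symm_next f).trans he)) hA
    ext1 f
    rw [← R.faceNext_symm, ← P.faceNext_symm]
    exact (hall f.symm f.symm (SameFace.refl R _)).symm
  · right
    ext1
    ext1 f
    have h2 : ∀ g, P.next g = R.next⁻¹ g := fun g => by
      have h1 := (h.faceNext_eq_or_of_hasGenus_zero hP hdeg g).resolve_left
        (fun h' => hex ⟨g, h'⟩) g (SameFace.refl R g)
      rwa [P.faceNext_symm, R.faceNext_inv_apply, SimpleGraph.Dart.symm_symm] at h1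
    rw [mirror_next, Equiv.Perm.eq_inv_iff_eq, h2]
    simp

end IsPolyhedralMap

end RotationSystem

/-! ### Contracting one side of a cut -/

/-- A contraction of a part of the graph `H` to the single vertex `v` of the graph `G`, such
that the edges of `G` correspond to the edges of `H` outside this part: `proj` is the map of the
vertices, and `lift` sends a directed edge of `G` to the directed edge of `H` it comes from. -/
structure Contraction {X V : Type*} (H : SimpleGraph X) (G : SimpleGraph V) (v : V) where
  proj : X → V
  lift : G.Dart → H.Dart
  lift_symm : ∀ e, lift e.symm = (lift e).symm
  proj_fst : ∀ e, proj (lift e).fst = e.fst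
  proj_inj : ∀ ⦃x y⦄, proj x = proj y → proj x ≠ v → x = y
  exists_lift : ∀ d : H.Dart, proj d.fst ≠ v → ∃ e, lift e = d

namespace Contraction

variable {X V W : Type*} {H : SimpleGraph X} {G : SimpleGraph V} {G' : SimpleGraph W} {v : V}
  {v' : W}

theorem proj_snd (C : Contraction H G v) (e : G.Dart) : C.proj (C.lift e).snd = e.snd := by
  have h := C.proj_fst e.symm
  rw [C.lift_symm] at h
  exact h

theorem lift_injective (C : Contraction H G v) : Function.Injective C.lift := fun e f hef =>
  SimpleGraph.Dart.eq_of_fst_of_snd (by rw [← C.proj_fst, hef, C.proj_fst])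
    (by rw [← C.proj_snd, hef, C.proj_snd])

/-- Two contractions of the same graph are complementary if each vertex is contracted by exactly
one of them. -/
def Complementary (C : Contraction H G v) (C' : Contraction H G' v') : Prop :=
  ∀ x, C.proj x = v ↔ C'.proj x ≠ v'

variable {C : Contraction H G v} {C' : Contraction H G' v'}

theorem Complementary.symm (h : C.Complementary C') : C'.Complementary C := fun x => by
  have := h x
  tauto

theorem Complementary.ne_iff (h : C.Complementary C') {x : X} : C.proj x ≠ v ↔ C'.proj x = v' :=
  (h.symm x).symm

/-- The directed edges ending in the contracted vertex leave the other contracted vertex. -/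
theorem Complementary.exists_lift_eq (h : C.Complementary C') {e : G.Dart} (he : e.snd = v) :
    ∃ e', C'.lift e' = C.lift e ∧ e'.fst = v' := by
  have h1 : C'.proj (C.lift e).symm.fst ≠ v' := (h _).mp ((C.proj_snd e).trans he)
  obtain ⟨e', he'⟩ := C'.exists_lift _ h1
  refine ⟨e'.symm, by rw [C'.lift_symm, he', SimpleGraph.Dart.symm_symm], ?_⟩
  change e'.snd = v'
  rw [← C'.proj_snd, he']
  refine h.ne_iff.mp ?_
  change C.proj (C.lift e).fst ≠ v
  rw [C.proj_fst, ← he]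
  exact e.fst_ne_snd

/-- The directed edges that survive both contractions are those at the contracted vertices. -/
theorem Complementary.fst_eq_or_snd_eq (h : C.Complementary C') {e : G.Dart} {e' : G'.Dart}
    (he : C.lift e = C'.lift e') : e.fst = v ∧ e'.snd = v' ∨ e.snd = v ∧ e'.fst = v' := by
  have h1 := h (C.lift e).fst
  have h2 := h (C.lift e).snd
  rw [C.proj_fst, he, C'.proj_fst] at h1
  rw [C.proj_snd, he, C'.proj_snd] at h2
  have h3 := e.fst_ne_snd
  have h4 := e'.fst_ne_snd
  by_cases h5 : e.fst = v <;> by_cases h6 : e.snd = v <;> by_cases h7 : e'.fst = v' <;>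
    by_cases h8 : e'.snd = v' <;> simp_all

/-- The rotation system `R` of the contracted graph agrees with the rotation system `S` away from
the contracted vertex. -/
def Restricts (C : Contraction H G v) (S : RotationSystem H) (R : RotationSystem G) : Prop :=
  ∀ e, e.fst ≠ v → C.lift (R.next e) = S.next (C.lift e)

theorem Restricts.faceNext {S : RotationSystem H} {R : RotationSystem G} (h : C.Restricts S R)
    {e : G.Dart} (he : e.snd ≠ v) : C.lift (R.faceNext e) = S.faceNext (C.lift e) := by
  rw [R.faceNext_apply, S.faceNext_apply, ← C.lift_symm]
  exact h _ he

theorem Restricts.mirror {S : RotationSystem H} {R : RotationSystem G} (h : C.Restricts S R) :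
    C.Restricts S.mirror R.mirror := by
  intro e he
  rw [R.mirror_next, S.mirror_next, Equiv.Perm.eq_inv_iff_eq, ← h]
  · simp
  · rwa [R.next_inv_fst]

/-- The rotations of `R` and `R'` at the contracted vertices are opposite to each other. -/
def Matching (C : Contraction H G v) (C' : Contraction H G' v') (R : RotationSystem G)
    (R' : RotationSystem G') : Prop :=
  ∀ e e', e.fst = v → C'.lift e' = (C.lift e).symm →
    C'.lift (R'.next e') = (C.lift (R.next⁻¹ e)).symm

theorem Matching.symm (hC : C.Complementary C') {R : RotationSystem G} {R' : RotationSystem G'}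
    (h : C.Matching C' R R') : C'.Matching C R' R := by
  intro e' e he' he
  obtain ⟨f, hf, hfv⟩ := hC.symm.exists_lift_eq (e := (R'.next⁻¹ e').symm)
    ((R'.next_inv_fst e').trans he')
  rw [C'.lift_symm] at hf
  have h1 := h f (R'.next⁻¹ e') hfv (by rw [hf, SimpleGraph.Dart.symm_symm])
  rw [R'.next_next_inv] at h1
  rw [h1, SimpleGraph.Dart.symm_symm] at he
  rw [C.lift_injective he, R.next_next_inv, hf]

theorem Matching.mirror (hC : C.Complementary C') {R : RotationSystem G} {R' : RotationSystem G'}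
    (h : C.Matching C' R R') : C.Matching C' R.mirror R'.mirror := by
  intro e e' he he'
  rw [R.mirror_next, R'.mirror_next, inv_inv]
  have he'v : e'.fst = v' := by
    rw [← C.lift_symm] at he'
    rcases hC.fst_eq_or_snd_eq he'.symm with h1 | h1
    · exact absurd (h1.1.trans he.symm) e.snd_ne_fst
    · exact h1.2
  have := h.symm hC e' e he'v (by rw [he', SimpleGraph.Dart.symm_symm])
  rw [this, SimpleGraph.Dart.symm_symm]

end Contraction

/-! ### Gluing two embeddings -/

/-- The rotation system `S` is obtained from `R` and `R'` by cutting out the two contracted vertices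
and gluing along the resulting boundaries; here every face of `R` and of `R'` passes at most
once through the contracted vertex. -/
structure IsGluing {X V W : Type*} {H : SimpleGraph X} {G : SimpleGraph V} {G' : SimpleGraph W}
    {v : V} {v' : W} (C : Contraction H G v) (C' : Contraction H G' v') (R : RotationSystem G)
    (R' : RotationSystem G') (S : RotationSystem H) : Prop where
  compl : C.Complementary C'
  restricts : C.Restricts S R
  restricts' : C'.Restricts S R'
  matching : C.Matching C' R R'
  simple : ∀ e f, R.SameFace e f → e.fst = v → f.fst = v → e = f
  simple' : ∀ e f, R'.SameFace e f → e.fst = v' → f.fst = v' → e = f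

namespace IsGluing

open RotationSystem

variable {X V W : Type*} {H : SimpleGraph X} {G : SimpleGraph V} {G' : SimpleGraph W} {v : V}
  {v' : W} {C : Contraction H G v} {C' : Contraction H G' v'} {R : RotationSystem G}
  {R' : RotationSystem G'} {S : RotationSystem H}

theorem symm (h : IsGluing C C' R R' S) : IsGluing C' C R' R S where
  compl := h.compl.symm
  restricts := h.restricts'
  restricts' := h.restricts
  matching := h.matching.symm h.compl
  simple := h.simple'
  simple' := h.simple

theorem mirror [Finite V] [Finite W] (h : IsGluing C C' R R' S) :
    IsGluing C C' R.mirror R'.mirror S.mirror where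
  compl := h.compl
  restricts := h.restricts.mirror
  restricts' := h.restricts'.mirror
  matching := h.matching.mirror h.compl
  simple e f hef he hf := by
    have h1 := sameFace_mirror_iff.mp hef
    exact R.next.injective (h.simple _ _ (h1.faceNext.symm.faceNext).symm
      ((R.next_fst e).trans he) ((R.next_fst f).trans hf))
  simple' e f hef he hf := by
    have h1 := sameFace_mirror_iff.mp hef
    exact R'.next.injective (h.simple' _ _ (h1.faceNext.symm.faceNext).symm
      ((R'.next_fst e).trans he) ((R'.next_fst f).trans hf))

/-- A face of `R` reaching the contracted vertex leaves it at the place where the face of `R'` that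
is glued to it enters the other contracted vertex. -/
theorem lift_faceNext_of_snd_eq (h : IsGluing C C' R R' S) {e : G.Dart} {e' : G'.Dart}
    (he : C.lift e = C'.lift e') (hev : e.snd = v) :
    C.lift (R.faceNext e) = C'.lift (R'.faceNext⁻¹ e') := by
  have he' : e'.fst = v' := by
    rcases h.compl.fst_eq_or_snd_eq he with h1 | h1
    · exact absurd (h1.1.trans hev.symm) e.fst_ne_snd
    · exact h1.2
  rw [R'.faceNext_inv_apply, C'.lift_symm, R.faceNext_apply]
  exact h.matching.symm h.compl e' e.symm he' (by rw [C.lift_symm, he])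

theorem sameFace_lift [Finite V] [Finite W] (h : IsGluing C C' R R' S) {e f : G.Dart}
    (hef : R.SameFace e f) : S.SameFace (C.lift e) (C.lift f) := by
  refine Equiv.Perm.SameCycle.induction (p := fun f => S.SameFace (C.lift e) (C.lift f)) hef
    (SameFace.refl S _) fun z _ hz => hz.trans ?_
  by_cases hzv : z.snd = v
  · obtain ⟨z', hz', hzv'⟩ := h.compl.exists_lift_eq hzv
    -- Follow the face of `R'` from the other contracted vertex until it returns there.
    have key : ∀ g, R'.SameFace z' g → S.SameFace (C'.lift z') (C'.lift g) := by
      intro g hg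
      refine Equiv.Perm.SameCycle.induction (p := fun g => S.SameFace (C'.lift z') (C'.lift g)) hg
        (SameFace.refl S _) fun w hw hw' => ?_
      by_cases hwv : w.snd = v'
      · rw [← h.simple' z' _ (SameFace.faceNext hw) hzv' ((R'.fst_faceNext w).trans hwv)]
        exact SameFace.refl S _
      · rw [h.restricts'.faceNext hwv]
        exact hw'.faceNext
    rw [h.lift_faceNext_of_snd_eq hz'.symm hzv, ← hz']
    exact key _ (SameFace.refl R' z').faceNext_inv
  · rw [h.restricts.faceNext hzv]
    exact S.sameFace_faceNext _

theorem exists_onFace_lift [Finite V] [Finite W] (h : IsGluing C C' R R' S) {e : G.Dart}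
    {x : V} (hx : R.OnFace e x) :
    ∃ y, C.proj y = x ∧ S.OnFace (C.lift e) y := by
  obtain ⟨f, hf, rfl⟩ := hx
  exact ⟨_, C.proj_fst f, (h.sameFace_lift hf).onFace_fst⟩

/-- If two directed edges survive both contractions and belong to the same face of `R'`, then they
belong to the same face of `R`. -/
theorem sameFace_of_sameFace' (h : IsGluing C C' R R' S) {f g : G.Dart} {f' g' : G'.Dart}
    (hf : C.lift f = C'.lift f') (hg : C.lift g = C'.lift g') (hfg : R'.SameFace f' g') :
    R.SameFace f g := by
  have key : ∀ {f : G.Dart} {f' : G'.Dart}, C.lift f = C'.lift f' →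
      ∃ e e', R.SameFace f e ∧ R'.SameFace f' e' ∧ e'.fst = v' ∧ C.lift e = C'.lift e' := by
    intro f f' hf
    rcases h.compl.fst_eq_or_snd_eq hf with ⟨h1, -⟩ | ⟨-, h1⟩
    · have hs : (R.faceNext⁻¹ f).snd = v := (R.snd_faceNext_inv f).trans h1
      obtain ⟨e', he', hev⟩ := h.compl.exists_lift_eq hs
      have h2 := h.lift_faceNext_of_snd_eq he'.symm hs
      rw [R.faceNext_faceNext_inv, hf] at h2
      refine ⟨_, e', (SameFace.refl R f).faceNext_inv, ?_, hev, he'.symm⟩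
      rw [C'.lift_injective h2]
      exact (SameFace.refl R' e').faceNext_inv.symm
    · exact ⟨f, f', SameFace.refl R f, SameFace.refl R' f', h1, hf⟩
  obtain ⟨e, e', h1, h2, h3, h4⟩ := key hf
  obtain ⟨d, d', h5, h6, h7, h8⟩ := key hg
  have h9 := h.simple' e' d' ((h2.symm.trans hfg).trans h6) h3 h7
  rw [← h9, ← h4] at h8
  rw [C.lift_injective h8] at h5
  exact h1.trans h5.symm

/-- The faces of `R` are the parts of the faces of `S` outside the contracted part. -/
theorem sameFace_lift_iff [Finite V] [Finite W] [Finite X] (h : IsGluing C C' R R' S)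
    {e f : G.Dart} : S.SameFace (C.lift e) (C.lift f) ↔ R.SameFace e f := by
  refine ⟨fun hef => ?_, h.sameFace_lift⟩
  let p : H.Dart → Prop := fun d => (∃ f, R.SameFace e f ∧ C.lift f = d) ∨
    ∃ g g' f, C'.lift g = d ∧ R'.SameFace g' g ∧ R.SameFace e f ∧ C.lift f = C'.lift g'
  have key : p (C.lift f) := by
    refine Equiv.Perm.SameCycle.induction (p := p) hef (Or.inl ⟨e, SameFace.refl R e, rfl⟩) ?_
    have h1 : ∀ f, R.SameFace e f → p (S.faceNext (C.lift f)) := by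
      intro f hf
      by_cases hfv : f.snd = v
      · obtain ⟨f', hf', hfv'⟩ := h.compl.exists_lift_eq hfv
        refine Or.inr ⟨R'.faceNext f', f', f, ?_, R'.sameFace_faceNext f', hf, hf'.symm⟩
        rw [← hf']
        refine h.restricts'.faceNext ?_
        rw [← hfv']
        exact f'.snd_ne_fst
      · exact Or.inl ⟨R.faceNext f, hf.faceNext, h.restricts.faceNext hfv⟩
    rintro _ - (⟨f, hf, rfl⟩ | ⟨g, g', f, rfl, hg, hf, hfg⟩)
    · exact h1 f hf
    · by_cases hgv : g.snd = v'
      · obtain ⟨k, hk, -⟩ := h.symm.compl.exists_lift_eq hgv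
        rw [← hk]
        exact h1 k (hf.trans (h.sameFace_of_sameFace' hfg hk hg))
      · exact Or.inr ⟨R'.faceNext g, g', f, h.restricts'.faceNext hgv, hg.faceNext, hf, hfg⟩
  rcases key with ⟨g, hg, hgf⟩ | ⟨g, g', k, hgf, hg, hk, hkg⟩
  · rwa [← C.lift_injective hgf]
  · exact hk.trans (h.sameFace_of_sameFace' hkg hgf.symm hg)

end IsGluing

namespace Contraction

open RotationSystem

variable {X V W : Type*} {H : SimpleGraph X} {G : SimpleGraph V} {G' : SimpleGraph W} {v : V}
  {v' : W} {C : Contraction H G v} {C' : Contraction H G' v'} {S : RotationSystem H}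

theorem exists_sameFace_lift {d : H.Dart} {x : X} (hx : S.OnFace d x) (hxv : C.proj x ≠ v) :
    ∃ e, S.SameFace d (C.lift e) := by
  obtain ⟨f, hf, rfl⟩ := hx
  obtain ⟨e, rfl⟩ := C.exists_lift f hxv
  exact ⟨e, hf⟩

/-- A face with vertices on both sides of the cut crosses the cut into the contracted part. -/
theorem exists_sameFace_lift_snd_eq [Finite X] {d : H.Dart} {x y : X}
    (hx : S.OnFace d x) (hxv : C.proj x ≠ v) (hy : S.OnFace d y) (hyv : C.proj y = v) :
    ∃ e, S.SameFace d (C.lift e) ∧ e.snd = v := by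
  by_contra! hcon
  obtain ⟨a, ha, rfl⟩ := hx
  obtain ⟨b, hb, rfl⟩ := hy
  refine Equiv.Perm.SameCycle.induction (p := fun b => C.proj b.fst ≠ v)
    (SameFace.trans ha.symm hb) hxv (fun z hz hzv => ?_) hyv
  obtain ⟨e, rfl⟩ := C.exists_lift z hzv
  rw [S.fst_faceNext, C.proj_snd]
  exact hcon e (ha.trans hz)

end Contraction

/-! ### Polyhedrality and genus of a glued embedding -/

namespace RotationSystem

variable {V : Type*} {G : SimpleGraph V} {R : RotationSystem G}

/-- Two faces of a polyhedral embedding have at most two common vertices. -/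
theorem IsPolyhedralMap.eq_or_eq_or_eq (h : R.IsPolyhedralMap) {d d' : G.Dart}
    (hd : ¬ R.SameFace d d') {x y z : V} (hx : R.OnFace d x ∧ R.OnFace d' x)
    (hy : R.OnFace d y ∧ R.OnFace d' y) (hz : R.OnFace d z ∧ R.OnFace d' z) :
    x = y ∨ x = z ∨ y = z := by
  by_contra! hne
  obtain ⟨e, -, -, he⟩ := h.inter hd hne.1 hx.1 hx.2 hy.1 hy.2
  rcases he x hx.1 hx.2 with h1 | h1 <;> rcases he y hy.1 hy.2 with h2 | h2 <;>
    rcases he z hz.1 hz.2 with h3 | h3 <;> simp_all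

end RotationSystem

namespace IsGluing

open RotationSystem

variable {X V W : Type*} [Finite X] [Finite V] [Finite W] {H : SimpleGraph X} {G : SimpleGraph V}
  {G' : SimpleGraph W} {v : V} {v' : W} {C : Contraction H G v} {C' : Contraction H G' v'}
  {R : RotationSystem G} {R' : RotationSystem G'} {S : RotationSystem H}

theorem onFace_proj (h : IsGluing C C' R R' S) {d : H.Dart} {e : G.Dart}
    (he : S.SameFace d (C.lift e)) {x : X} (hx : S.OnFace d x) : R.OnFace e (C.proj x) := by
  replace hx := he.symm.onFace hx
  by_cases hxv : C.proj x = v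
  · rw [hxv]
    by_cases hev : e.fst = v
    · exact ⟨e, SameFace.refl R e, hev⟩
    · obtain ⟨f, hf, rfl⟩ := C.exists_sameFace_lift_snd_eq (SameFace.refl S _).onFace_fst
        (by rwa [C.proj_fst]) hx hxv
      exact (h.sameFace_lift_iff.mp hf).onFace_snd
  · obtain ⟨f, hf, rfl⟩ := hx
    obtain ⟨f, rfl⟩ := C.exists_lift f hxv
    rw [C.proj_fst]
    exact (h.sameFace_lift_iff.mp hf).onFace_fst

/-- Two common vertices of two faces on the uncontracted side span a common edge. -/
theorem inter_of_ne_of_ne (h : IsGluing C C' R R' S) (hR : R.IsPolyhedralMap) {d d' : H.Dart}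
    (hd : ¬ S.SameFace d d') {x y : X} (hxy : x ≠ y) (hxv : C.proj x ≠ v) (hyv : C.proj y ≠ v)
    (hx : S.OnFace d x ∧ S.OnFace d' x) (hy : S.OnFace d y ∧ S.OnFace d' y) :
    ∃ e, S.SameFace d e ∧ S.SameFace d' e.symm ∧
      ∀ z, S.OnFace d z → S.OnFace d' z → z = e.fst ∨ z = e.snd := by
  obtain ⟨a, ha⟩ := C.exists_sameFace_lift hx.1 hxv
  obtain ⟨b, hb⟩ := C.exists_sameFace_lift hx.2 hxv
  have hab : ¬ R.SameFace a b := fun h' => hd ((ha.trans (h.sameFace_lift h')).trans hb.symm)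
  have hpxy : C.proj x ≠ C.proj y := fun h' => hxy (C.proj_inj h' hxv)
  obtain ⟨e, hae, hbe, he⟩ := hR.inter hab hpxy (h.onFace_proj ha hx.1) (h.onFace_proj hb hx.2)
    (h.onFace_proj ha hy.1) (h.onFace_proj hb hy.2)
  have hx' := he _ (h.onFace_proj ha hx.1) (h.onFace_proj hb hx.2)
  have hy' := he _ (h.onFace_proj ha hy.1) (h.onFace_proj hb hy.2)
  have hev : e.fst ≠ v ∧ e.snd ≠ v := by
    rcases hx' with h1 | h1 <;> rcases hy' with h2 | h2
    · exact absurd (h1.trans h2.symm) hpxy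
    · exact ⟨h1 ▸ hxv, h2 ▸ hyv⟩
    · exact ⟨h2 ▸ hyv, h1 ▸ hxv⟩
    · exact absurd (h1.trans h2.symm) hpxy
  refine ⟨C.lift e, ha.trans (h.sameFace_lift hae), ?_, fun z hz hz' => ?_⟩
  · rw [← C.lift_symm]
    exact hb.trans (h.sameFace_lift hbe)
  · rcases he _ (h.onFace_proj ha hz) (h.onFace_proj hb hz') with h1 | h1
    · left
      rw [← C.proj_fst] at h1
      exact (C.proj_inj h1.symm (by rw [C.proj_fst]; exact hev.1)).symm
    · right
      rw [← C.proj_snd] at h1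
      exact (C.proj_inj h1.symm (by rw [C.proj_snd]; exact hev.2)).symm

/-- Two common vertices of two faces on different sides of the cut span a common edge. -/
theorem inter_of_ne_of_eq (h : IsGluing C C' R R' S) (hR : R.IsPolyhedralMap)
    (hR' : R'.IsPolyhedralMap) {d d' : H.Dart} (hd : ¬ S.SameFace d d') {x y : X}
    (hxv : C.proj x ≠ v) (hyv : C.proj y = v) (hx : S.OnFace d x ∧ S.OnFace d' x)
    (hy : S.OnFace d y ∧ S.OnFace d' y) :
    ∃ e, S.SameFace d e ∧ S.SameFace d' e.symm ∧
      ∀ z, S.OnFace d z → S.OnFace d' z → z = e.fst ∨ z = e.snd := by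
  obtain ⟨a, ha⟩ := C.exists_sameFace_lift hx.1 hxv
  obtain ⟨b, hb⟩ := C.exists_sameFace_lift hx.2 hxv
  have hab : ¬ R.SameFace a b := fun h' => hd ((ha.trans (h.sameFace_lift h')).trans hb.symm)
  have hyv' := (h.compl y).mp hyv
  have hxv' := h.compl.ne_iff.mp hxv
  obtain ⟨a', ha'⟩ := C'.exists_sameFace_lift hy.1 hyv'
  obtain ⟨b', hb'⟩ := C'.exists_sameFace_lift hy.2 hyv'
  have hab' : ¬ R'.SameFace a' b' := fun h' =>
    hd ((ha'.trans (h.symm.sameFace_lift h')).trans hb'.symm)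
  have hp : ∀ z, S.OnFace d z ∧ S.OnFace d' z → R.OnFace a (C.proj z) ∧ R.OnFace b (C.proj z) :=
    fun z hz => ⟨h.onFace_proj ha hz.1, h.onFace_proj hb hz.2⟩
  have hp' : ∀ z, S.OnFace d z ∧ S.OnFace d' z →
      R'.OnFace a' (C'.proj z) ∧ R'.OnFace b' (C'.proj z) :=
    fun z hz => ⟨h.symm.onFace_proj ha' hz.1, h.symm.onFace_proj hb' hz.2⟩
  -- The two faces have only one common vertex on each side.
  have hleft : ∀ z, S.OnFace d z ∧ S.OnFace d' z → C.proj z ≠ v → z = x := by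
    intro z hz hzv
    rcases hR.eq_or_eq_or_eq hab (hp z hz) (hp x hx) (hp y hy) with h1 | h1 | h1
    · exact C.proj_inj h1 hzv
    · exact absurd (h1.trans hyv) hzv
    · exact absurd (h1.trans hyv) hxv
  have hright : ∀ z, S.OnFace d z ∧ S.OnFace d' z → C.proj z = v → z = y := by
    intro z hz hzv
    have hzv' := (h.compl z).mp hzv
    rcases hR'.eq_or_eq_or_eq hab' (hp' z hz) (hp' y hy) (hp' x hx) with h1 | h1 | h1
    · exact C'.proj_inj h1 hzv'
    · exact absurd (h1.trans hxv') hzv'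
    · exact absurd (h1.trans hxv') hyv'
  obtain ⟨e, hae, hbe, he⟩ := hR.inter hab (x := C.proj x) (y := C.proj y) (by rwa [hyv])
    (hp x hx).1 (hp x hx).2 (hp y hy).1 (hp y hy).2
  have h1 : S.SameFace d (C.lift e) := ha.trans (h.sameFace_lift hae)
  have h2 : S.SameFace d' (C.lift e).symm := by
    rw [← C.lift_symm]
    exact hb.trans (h.sameFace_lift hbe)
  refine ⟨C.lift e, h1, h2, fun z hz hz' => ?_⟩
  have hfst := And.intro h1.onFace_fst h2.onFace_snd
  have hsnd := And.intro h1.onFace_snd h2.onFace_fst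
  have hz2 : z = x ∨ z = y := by
    by_cases hzv : C.proj z = v
    · exact Or.inr (hright z ⟨hz, hz'⟩ hzv)
    · exact Or.inl (hleft z ⟨hz, hz'⟩ hzv)
  have hev := he _ (hp y hy).1 (hp y hy).2
  rw [hyv] at hev
  rcases hev with hev | hev
  · have h3 := hright _ hfst (by rw [C.proj_fst, hev])
    have h4 := hleft _ hsnd (by rw [C.proj_snd, hev]; exact e.snd_ne_fst)
    rcases hz2 with rfl | rfl
    · exact Or.inr h4.symm
    · exact Or.inl h3.symm
  · have h3 := hright _ hsnd (by rw [C.proj_snd, hev])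
    have h4 := hleft _ hfst (by rw [C.proj_fst, hev]; exact e.fst_ne_snd)
    rcases hz2 with rfl | rfl
    · exact Or.inl h4.symm
    · exact Or.inr h3.symm

/-- Gluing two polyhedral embeddings results in a polyhedral embedding. -/
theorem isPolyhedralMap (h : IsGluing C C' R R' S) (hR : R.IsPolyhedralMap)
    (hR' : R'.IsPolyhedralMap) (hH : H.Connected) : S.IsPolyhedralMap where
  connected := hH
  next_ne d hd := by
    by_cases hdv : C.proj d.fst = v
    · obtain ⟨e, rfl⟩ := C'.exists_lift d ((h.compl _).mp hdv)
      rw [← h.restricts' e (by rw [← C'.proj_fst]; exact (h.compl _).mp hdv)] at hd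
      exact hR'.next_ne e (C'.lift_injective hd)
    · obtain ⟨e, rfl⟩ := C.exists_lift d hdv
      rw [← h.restricts e (by rwa [← C.proj_fst])] at hd
      exact hR.next_ne e (C.lift_injective hd)
  simple d e hde hf := by
    by_cases hdv : C.proj d.fst = v
    · obtain ⟨a, rfl⟩ := C'.exists_lift d ((h.compl _).mp hdv)
      obtain ⟨b, rfl⟩ := C'.exists_lift e (hf ▸ (h.compl _).mp hdv)
      rw [hR'.simple (h.symm.sameFace_lift_iff.mp hde) (by rw [← C'.proj_fst, hf, C'.proj_fst])]
    · obtain ⟨a, rfl⟩ := C.exists_lift d hdv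
      obtain ⟨b, rfl⟩ := C.exists_lift e (hf ▸ hdv)
      rw [hR.simple (h.sameFace_lift_iff.mp hde) (by rw [← C.proj_fst, hf, C.proj_fst])]
  inter d d' hd x y hxy hx hx' hy hy' := by
    by_cases hxv : C.proj x = v <;> by_cases hyv : C.proj y = v
    · exact h.symm.inter_of_ne_of_ne hR' hd hxy ((h.compl _).mp hxv) ((h.compl _).mp hyv)
        ⟨hx, hx'⟩ ⟨hy, hy'⟩
    · exact h.inter_of_ne_of_eq hR hR' hd hyv hxv ⟨hy, hy'⟩ ⟨hx, hx'⟩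
    · exact h.inter_of_ne_of_eq hR hR' hd hxv hyv ⟨hx, hx'⟩ ⟨hy, hy'⟩
    · exact h.inter_of_ne_of_ne hR hd hxy hxv hyv ⟨hx, hx'⟩ ⟨hy, hy'⟩

/-- If the glued embedding is polyhedral, then so are the two embeddings it is glued from, where
the contracted vertex has degree three: hence any two faces at this vertex share an edge. -/
theorem isPolyhedralMap_left (h : IsGluing C C' R R' S) (hS : S.IsPolyhedralMap)
    (hG : G.Connected) (hne : ∀ e, e.fst = v → R.next e ≠ e)
    (hdeg : ∀ e f, e.fst = v → f.fst = v → e ≠ f → R.next e = f ∨ R.next f = e) :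
    R.IsPolyhedralMap where
  connected := hG
  next_ne e he := by
    by_cases hev : e.fst = v
    · exact hne e hev he
    · have := h.restricts e hev
      rw [he] at this
      exact hS.next_ne _ this.symm
  simple d e hde hf := by
    by_cases hdv : d.fst = v
    · exact h.simple d e hde hdv (hf ▸ hdv)
    · refine C.lift_injective (hS.simple (h.sameFace_lift hde) (C.proj_inj ?_ ?_))
      · rw [C.proj_fst, C.proj_fst, hf]
      · rwa [C.proj_fst]
  inter d d' hd x y hxy hx hx' hy hy' := by
    have hd' : ¬ S.SameFace (C.lift d) (C.lift d') := fun h' => hd (h.sameFace_lift_iff.mp h')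
    have hcommon : ∀ z, z ≠ v → R.OnFace d z → R.OnFace d' z →
        ∃ z', C.proj z' = z ∧ S.OnFace (C.lift d) z' ∧ S.OnFace (C.lift d') z' := by
      intro z hzv hz hz'
      obtain ⟨z₁, h1, h2⟩ := h.exists_onFace_lift hz
      obtain ⟨z₂, h3, h4⟩ := h.exists_onFace_lift hz'
      refine ⟨z₁, h1, h2, ?_⟩
      rwa [C.proj_inj (h1.trans h3.symm) (h1 ▸ hzv)]
    by_cases hv : R.OnFace d v ∧ R.OnFace d' v
    · -- The edge at the contracted vertex that the two faces have in common.
      obtain ⟨e, hde, hde', hev⟩ : ∃ e, R.SameFace d e ∧ R.SameFace d' e.symm ∧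
          (e.fst = v ∨ e.snd = v) := by
        obtain ⟨⟨a, ha, hav⟩, b, hb, hbv⟩ := hv
        have hab : a ≠ b := by
          rintro rfl
          exact hd (ha.trans hb.symm)
        rcases hdeg a b hav hbv hab with rfl | rfl
        · exact ⟨a, ha, hb.trans (R.sameFace_symm_next a).symm, Or.inl hav⟩
        · refine ⟨b.symm, ha.trans (R.sameFace_symm_next b).symm, ?_, Or.inr hbv⟩
          rwa [SimpleGraph.Dart.symm_symm]
      refine ⟨e, hde, hde', fun z hz hz' => ?_⟩
      by_contra! hcon
      have hzv : z ≠ v := by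
        rintro rfl
        rcases hev with h1 | h1
        · exact hcon.1 h1.symm
        · exact hcon.2 h1.symm
      obtain ⟨z', rfl, hz1⟩ := hcommon z hzv hz hz'
      have h1 := h.sameFace_lift hde
      have h2 := h.sameFace_lift hde'
      rw [C.lift_symm] at h2
      rcases hS.eq_or_eq_or_eq hd' hz1 ⟨h1.onFace_fst, h2.onFace_snd⟩
        ⟨h1.onFace_snd, h2.onFace_fst⟩ with h3 | h3 | h3
      · exact hcon.1 (by rw [h3, C.proj_fst])
      · exact hcon.2 (by rw [h3, C.proj_snd])
      · exact (C.lift e).fst_ne_snd h3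
    · have hxv : ∀ z, R.OnFace d z → R.OnFace d' z → z ≠ v := by
        rintro z hz hz' rfl
        exact hv ⟨hz, hz'⟩
      obtain ⟨x', rfl, hx1⟩ := hcommon x (hxv x hx hx') hx hx'
      obtain ⟨y', rfl, hy1⟩ := hcommon y (hxv y hy hy') hy hy'
      obtain ⟨e, he, he', hz⟩ := hS.inter hd' (fun h' => hxy (congrArg C.proj h')) hx1.1 hx1.2
        hy1.1 hy1.2
      have hev : C.proj e.fst ≠ v := by
        rcases hz _ hx1.1 hx1.2 with h1 | h1 <;> rcases hz _ hy1.1 hy1.2 with h2 | h2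
        · exact h1 ▸ hxv _ hx hx'
        · exact h1 ▸ hxv _ hx hx'
        · exact h2 ▸ hxv _ hy hy'
        · exact absurd (congrArg C.proj (h1.trans h2.symm)) hxy
      obtain ⟨e, rfl⟩ := C.exists_lift e hev
      rw [← C.lift_symm] at he'
      refine ⟨e, h.sameFace_lift_iff.mp he, h.sameFace_lift_iff.mp he', fun z h1 h2 => ?_⟩
      obtain ⟨z', rfl, hz1⟩ := hcommon z (hxv z h1 h2) h1 h2
      rcases hz _ hz1.1 hz1.2 with h3 | h3
      · exact Or.inl (by rw [h3, C.proj_fst])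
      · exact Or.inr (by rw [h3, C.proj_snd])

/-- The number of faces of a glued embedding: of the faces of `R` and `R'`, those at the contracted
vertices are glued in pairs. -/
theorem card_faces (h : IsGluing C C' R R' S) :
    Nat.card (Quotient (Equiv.Perm.SameCycle.setoid S.faceNext)) +
      Nat.card {e : G.Dart // e.fst = v} =
    Nat.card (Quotient (Equiv.Perm.SameCycle.setoid R.faceNext)) +
      Nat.card (Quotient (Equiv.Perm.SameCycle.setoid R'.faceNext)) := by
  let q : Quotient (Equiv.Perm.SameCycle.setoid R.faceNext) →
      Quotient (Equiv.Perm.SameCycle.setoid S.faceNext) :=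
    Quotient.map C.lift fun _ _ => h.sameFace_lift
  let q' : Quotient (Equiv.Perm.SameCycle.setoid R'.faceNext) →
      Quotient (Equiv.Perm.SameCycle.setoid S.faceNext) :=
    Quotient.map C'.lift fun _ _ => h.symm.sameFace_lift
  have hq : Function.Injective q := by
    rintro ⟨e⟩ ⟨f⟩ hef
    exact Quotient.sound (h.sameFace_lift_iff.mp (Quotient.exact hef))
  have hq' : Function.Injective q' := by
    rintro ⟨e⟩ ⟨f⟩ hef
    exact Quotient.sound (h.symm.sameFace_lift_iff.mp (Quotient.exact hef))
  have hunion : Set.range q ∪ Set.range q' = Set.univ := by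
    refine Set.eq_univ_of_forall ?_
    rintro ⟨d⟩
    by_cases hd : C.proj d.fst = v
    · obtain ⟨e, rfl⟩ := C'.exists_lift d ((h.compl _).mp hd)
      exact Or.inr ⟨Quotient.mk _ e, rfl⟩
    · obtain ⟨e, rfl⟩ := C.exists_lift d hd
      exact Or.inl ⟨Quotient.mk _ e, rfl⟩
  let r : {e : G.Dart // e.fst = v} → Quotient (Equiv.Perm.SameCycle.setoid S.faceNext) :=
    fun e => Quotient.mk _ (C.lift e)
  have hr : Function.Injective r := fun e f hef =>
    Subtype.ext (h.simple _ _ (h.sameFace_lift_iff.mp (Quotient.exact hef)) e.2 f.2)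
  have hinter : Set.range q ∩ Set.range q' = Set.range r := by
    ext c
    constructor
    · rintro ⟨⟨⟨e⟩, rfl⟩, ⟨e'⟩, he'⟩
      have hee : S.SameFace (C.lift e) (C'.lift e') := SameFace.symm (Quotient.exact he')
      by_cases hev : e.fst = v
      · exact ⟨⟨e, hev⟩, rfl⟩
      · obtain ⟨x, hx, hxv⟩ : ∃ x, S.OnFace (C.lift e) x ∧ C.proj x = v := by
          by_cases hev' : e'.fst = v'
          · refine ⟨_, hee.onFace_snd, (h.compl _).mpr ?_⟩
            rw [C'.proj_snd, ← hev']
            exact e'.snd_ne_fst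
          · refine ⟨_, hee.onFace_fst, (h.compl _).mpr ?_⟩
            rwa [C'.proj_fst]
        obtain ⟨f, hf, hfv⟩ := C.exists_sameFace_lift_snd_eq (SameFace.refl S _).onFace_fst
          (by rwa [C.proj_fst]) hx hxv
        refine ⟨⟨R.faceNext f, (R.fst_faceNext f).trans hfv⟩, Quotient.sound ?_⟩
        exact (hf.trans (h.sameFace_lift (R.sameFace_faceNext f))).symm
    · rintro ⟨⟨e, he⟩, rfl⟩
      obtain ⟨e', he', -⟩ := h.compl.exists_lift_eq (e := e.symm) he
      refine ⟨⟨Quotient.mk _ e, rfl⟩, Quotient.mk _ e'.symm, ?_⟩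
      change Quotient.mk _ (C'.lift e'.symm) = Quotient.mk _ (C.lift e)
      rw [C'.lift_symm, he', C.lift_symm, SimpleGraph.Dart.symm_symm]
  have hcard := Set.ncard_union_add_ncard_inter (Set.range q) (Set.range q')
  rw [hunion, hinter, Set.ncard_univ] at hcard
  rwa [← Nat.card_coe_set_eq, ← Nat.card_coe_set_eq, ← Nat.card_coe_set_eq,
    Nat.card_range_of_injective hq, Nat.card_range_of_injective hq',
    Nat.card_range_of_injective hr] at hcard

end IsGluing

/-- The number of directed edges before and after contracting the two sides of a cut. -/
theorem Contraction.Complementary.card_dart {X V W : Type*} [Finite X] [Finite V] [Finite W]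
    {H : SimpleGraph X} {G : SimpleGraph V} {G' : SimpleGraph W} {v : V} {v' : W}
    {C : Contraction H G v} {C' : Contraction H G' v'} (h : C.Complementary C') :
    Nat.card H.Dart + 2 * Nat.card {e : G.Dart // e.fst = v} =
      Nat.card G.Dart + Nat.card G'.Dart := by
  have hunion : Set.range C.lift ∪ Set.range C'.lift = Set.univ := by
    refine Set.eq_univ_of_forall fun d => ?_
    by_cases hd : C.proj d.fst = v
    · exact Or.inr (C'.exists_lift d ((h _).mp hd))
    · exact Or.inl (C.exists_lift d hd)
  have hinter : Set.range C.lift ∩ Set.range C'.lift =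
      C.lift '' ({e | e.fst = v} ∪ SimpleGraph.Dart.symm '' {e | e.fst = v}) := by
    ext d
    constructor
    · rintro ⟨⟨e, rfl⟩, e', he'⟩
      rcases h.fst_eq_or_snd_eq he'.symm with h1 | h1
      · exact ⟨e, Or.inl h1.1, rfl⟩
      · exact ⟨e, Or.inr ⟨e.symm, h1.1, e.symm_symm⟩, rfl⟩
    · rintro ⟨_, he | ⟨e, he, rfl⟩, rfl⟩
      · rename_i e
        obtain ⟨e', he', -⟩ := h.exists_lift_eq (e := e.symm) he
        exact ⟨⟨e, rfl⟩, e'.symm, by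
          rw [C'.lift_symm, he', C.lift_symm, SimpleGraph.Dart.symm_symm]⟩
      · obtain ⟨e', he', -⟩ := h.exists_lift_eq (e := e.symm) he
        exact ⟨⟨_, rfl⟩, e', he'⟩
  have hdisj : Disjoint {e : G.Dart | e.fst = v} (SimpleGraph.Dart.symm '' {e | e.fst = v}) := by
    rw [Set.disjoint_left]
    rintro _ he ⟨e, he', rfl⟩
    exact e.fst_ne_snd ((he' : e.fst = v).trans (he : e.snd = v).symm)
  have hcard := Set.ncard_union_add_ncard_inter (Set.range C.lift) (Set.range C'.lift)
  rw [hunion, hinter, Set.ncard_univ, Set.ncard_image_of_injective _ C.lift_injective,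
    Set.ncard_union_eq hdisj,
    Set.ncard_image_of_injective _ SimpleGraph.Dart.symm_involutive.injective,
    ← Nat.card_coe_set_eq, ← Nat.card_coe_set_eq, ← Nat.card_coe_set_eq,
    Nat.card_range_of_injective C.lift_injective,
    Nat.card_range_of_injective C'.lift_injective, ← two_mul] at hcard
  exact hcard

/-! ### Cubic vertices -/

/-- A permutation of three points without fixed points is a cycle. -/
theorem Equiv.Perm.eq_or_eq_or_eq_of_card_eq_three {T : Type*} (hT : Nat.card T = 3)
    (f : Equiv.Perm T) (hf : ∀ i, f i ≠ i) (i j : T) :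
    i = j ∨ f i = j ∨ f (f i) = j ∧ f j = i := by
  have key : ∀ f : Equiv.Perm (Fin 3), (∀ i, f i ≠ i) →
      ∀ i j, i = j ∨ f i = j ∨ f (f i) = j ∧ f j = i := by
    decide
  have : Finite T := Nat.finite_of_card_ne_zero (by omega)
  let p : T ≃ Fin 3 := Finite.equivFinOfCardEq hT
  have h := key (p.permCongr f) (fun i h => hf (p.symm i)
    (p.injective (by simpa [Equiv.permCongr_apply] using h))) (p i) (p j)
  simpa [Equiv.permCongr_apply] using h

/-- Two permutations of three points without fixed points are equal or inverse to each other. -/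
theorem Equiv.Perm.eq_or_eq_inv_of_card_eq_three {T : Type*} (hT : Nat.card T = 3)
    (f g : Equiv.Perm T) (hf : ∀ i, f i ≠ i) (hg : ∀ i, g i ≠ i) : f = g ∨ f = g⁻¹ := by
  have key : ∀ f g : Equiv.Perm (Fin 3), (∀ i, f i ≠ i) → (∀ i, g i ≠ i) → f = g ∨ f * g = 1 := by
    decide
  have : Finite T := Nat.finite_of_card_ne_zero (by omega)
  let p : T ≃ Fin 3 := Finite.equivFinOfCardEq hT
  have hp : ∀ f : Equiv.Perm T, (∀ i, f i ≠ i) → ∀ i, p.permCongrHom f i ≠ i := fun f hf i h =>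
    hf (p.symm i) (p.injective (by simpa [Equiv.permCongr_apply] using h))
  rcases key (p.permCongrHom f) (p.permCongrHom g) (hp f hf) (hp g hg) with h | h
  · exact Or.inl (p.permCongrHom.injective h)
  · rw [← map_mul] at h
    exact Or.inr (mul_eq_one_iff_eq_inv.mp ((map_eq_one_iff _ p.permCongrHom.injective).mp h))

namespace RotationSystem

variable {V : Type*} {G : SimpleGraph V} {v : V}

/-- The rotation at the vertex `v`. -/
def rotationAt (R : RotationSystem G) (v : V) : Equiv.Perm {e : G.Dart // e.fst = v} :=
  R.next.subtypePerm fun e => by rw [R.next_fst]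

theorem rotationAt_apply (R : RotationSystem G) (e : {e : G.Dart // e.fst = v}) :
    (R.rotationAt v e : G.Dart) = R.next e := rfl

theorem next_ne_of_card_eq_three [Finite V] (R : RotationSystem G)
    (h3 : Nat.card {e : G.Dart // e.fst = v} = 3) {e : G.Dart} (he : e.fst = v) :
    R.next e ≠ e := by
  intro h
  have hall : ∀ f : {e : G.Dart // e.fst = v}, f = ⟨e, he⟩ := fun f =>
    Subtype.ext ((R.sameCycle e f (he.trans f.2.symm)).induction (p := fun f => f = e) rfl
      fun z _ hz => by rw [hz, h])
  have : Subsingleton {e : G.Dart // e.fst = v} := ⟨fun a b => (hall a).trans (hall b).symm⟩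
  have := Finite.card_le_one_iff_subsingleton.mpr this
  omega

theorem rotationAt_ne [Finite V] (R : RotationSystem G)
    (h3 : Nat.card {e : G.Dart // e.fst = v} = 3) (e : {e : G.Dart // e.fst = v}) :
    R.rotationAt v e ≠ e := fun h =>
  R.next_ne_of_card_eq_three h3 e.2 (congrArg Subtype.val h)

theorem next_eq_or_next_eq [Finite V] (R : RotationSystem G)
    (h3 : Nat.card {e : G.Dart // e.fst = v} = 3) {e f : G.Dart} (he : e.fst = v) (hf : f.fst = v)
    (hef : e ≠ f) : R.next e = f ∨ R.next f = e := by
  rcases (R.rotationAt v).eq_or_eq_or_eq_of_card_eq_three h3 (R.rotationAt_ne h3) ⟨e, he⟩ ⟨f, hf⟩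
    with h | h | ⟨-, h⟩
  · exact absurd (congrArg Subtype.val h) hef
  · exact Or.inl (congrArg Subtype.val h)
  · exact Or.inr (congrArg Subtype.val h)

/-- A map permuting the directed edges cyclically around each vertex is a rotation system. -/
noncomputable def ofFun [Finite V] (f : G.Dart → G.Dart) (hf : ∀ e, (f e).fst = e.fst)
    (hcyc : ∀ d e : G.Dart, d.fst = e.fst → ∃ n, f^[n] d = e) : RotationSystem G where
  next := Equiv.ofBijective f <| Finite.injective_iff_bijective.mp <|
    Finite.injective_iff_surjective.mpr fun e => by
      obtain ⟨n, hn⟩ := hcyc (f e) e (hf e)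
      refine ⟨f^[n] e, ?_⟩
      rwa [← Function.iterate_succ_apply' f n e]
  next_fst := hf
  sameCycle d e hde := by
    obtain ⟨n, hn⟩ := hcyc d e hde
    refine ⟨n, ?_⟩
    rw [zpow_natCast, Equiv.Perm.coe_pow]
    exact hn

end RotationSystem

/-! ### Restricting a polyhedral embedding to one side of a cut with three edges -/

namespace Contraction

open RotationSystem

variable {X V W : Type*} {H : SimpleGraph X} {G : SimpleGraph V} {G' : SimpleGraph W} {v : V}
  {v' : W} {C : Contraction H G v} {C' : Contraction H G' v'} {S : RotationSystem H}

/-- A face leaves the contracted part as often as it enters it. -/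
theorem ncard_exits_eq_ncard_entries [Finite X] [Finite V] (C : Contraction H G v)
    (S : RotationSystem H) (d : H.Dart) :
    {e : G.Dart | e.fst = v ∧ S.SameFace d (C.lift e)}.ncard =
      {e : G.Dart | e.fst = v ∧ S.SameFace d (C.lift e.symm)}.ncard := by
  set A := {e : G.Dart | e.fst = v ∧ S.SameFace d (C.lift e)}
  set B := {e : G.Dart | e.fst = v ∧ S.SameFace d (C.lift e.symm)}
  let K : Set H.Dart := {z | S.SameFace d z ∧ C.proj z.fst = v ∧ C.proj z.snd = v}
  have hA : {z | S.SameFace d z ∧ C.proj z.fst = v} = C.lift '' A ∪ K := by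
    ext z
    constructor
    · rintro ⟨hz, hzv⟩
      by_cases hz' : C.proj z.snd = v
      · exact Or.inr ⟨hz, hzv, hz'⟩
      · obtain ⟨e, he⟩ := C.exists_lift z.symm hz'
        have he' : C.lift e.symm = z := by rw [C.lift_symm, he, SimpleGraph.Dart.symm_symm]
        refine Or.inl ⟨e.symm, ⟨?_, by rwa [he']⟩, he'⟩
        rw [← C.proj_fst, he', hzv]
    · rintro (⟨e, ⟨he, hde⟩, rfl⟩ | ⟨hz, hzv, -⟩)
      · exact ⟨hde, by rw [C.proj_fst, he]⟩
      · exact ⟨hz, hzv⟩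
  have hB : {z | S.SameFace d z ∧ C.proj z.snd = v} = (fun e => C.lift e.symm) '' B ∪ K := by
    ext z
    constructor
    · rintro ⟨hz, hzv⟩
      by_cases hz' : C.proj z.fst = v
      · exact Or.inr ⟨hz, hz', hzv⟩
      · obtain ⟨e, rfl⟩ := C.exists_lift z hz'
        refine Or.inl ⟨e.symm, ⟨?_, by rwa [SimpleGraph.Dart.symm_symm]⟩,
          by simp only [SimpleGraph.Dart.symm_symm]⟩
        rw [← hzv, C.proj_snd]
        rfl
    · rintro (⟨e, ⟨he, hde⟩, rfl⟩ | ⟨hz, -, hzv⟩)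
      · exact ⟨hde, by rw [C.proj_snd]; exact he⟩
      · exact ⟨hz, hzv⟩
  have hAB : S.faceNext '' {z | S.SameFace d z ∧ C.proj z.snd = v} =
      {z | S.SameFace d z ∧ C.proj z.fst = v} := by
    ext z
    constructor
    · rintro ⟨w, ⟨hw, hwv⟩, rfl⟩
      exact ⟨hw.faceNext, by rwa [S.fst_faceNext]⟩
    · rintro ⟨hz, hzv⟩
      exact ⟨S.faceNext⁻¹ z, ⟨hz.faceNext_inv, by rwa [S.snd_faceNext_inv]⟩,
        S.faceNext_faceNext_inv z⟩
  have hcard := Set.ncard_image_of_injective {z | S.SameFace d z ∧ C.proj z.snd = v}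
    S.faceNext.injective
  have hinj : Function.Injective fun e : G.Dart => C.lift e.symm :=
    C.lift_injective.comp SimpleGraph.Dart.symm_involutive.injective
  rw [hAB, hA, hB, Set.ncard_union_eq, Set.ncard_union_eq,
    Set.ncard_image_of_injective _ C.lift_injective, Set.ncard_image_of_injective _ hinj] at hcard
  · omega
  · rw [Set.disjoint_left]
    rintro _ ⟨e, -, rfl⟩ ⟨-, h1, h2⟩
    rw [C.proj_fst] at h1
    rw [C.proj_snd] at h2
    exact e.symm.fst_ne_snd (h1.trans h2.symm)
  · rw [Set.disjoint_left]
    rintro _ ⟨e, -, rfl⟩ ⟨-, h1, h2⟩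
    rw [C.proj_fst] at h1
    rw [C.proj_snd] at h2
    exact e.fst_ne_snd (h1.trans h2.symm)

/-- A face of a polyhedral embedding crosses a cut with three edges at most once in each direction,
since it does not use an edge in both directions. -/
theorem ncard_exits_le_one [Finite X] [Finite V] (C : Contraction H G v) (hS : S.IsPolyhedralMap)
    (h3 : Nat.card {e : G.Dart // e.fst = v} = 3) (d : H.Dart) :
    {e : G.Dart | e.fst = v ∧ S.SameFace d (C.lift e)}.ncard ≤ 1 := by
  have h := C.ncard_exits_eq_ncard_entries S d
  have hdisj : Disjoint {e : G.Dart | e.fst = v ∧ S.SameFace d (C.lift e)}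
      {e : G.Dart | e.fst = v ∧ S.SameFace d (C.lift e.symm)} := by
    rw [Set.disjoint_left]
    rintro e ⟨-, h1⟩ ⟨-, h2⟩
    rw [C.lift_symm] at h2
    exact hS.not_sameFace_symm _ (h1.symm.trans h2)
  have hle : ({e : G.Dart | e.fst = v ∧ S.SameFace d (C.lift e)} ∪
      {e : G.Dart | e.fst = v ∧ S.SameFace d (C.lift e.symm)}).ncard ≤
        {e : G.Dart | e.fst = v}.ncard :=
    Set.ncard_le_ncard (Set.union_subset (fun e he => he.1) fun e he => he.1)
  rw [Set.ncard_union_eq hdisj] at hle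
  have h4 : {e : G.Dart | e.fst = v}.ncard = 3 := by
    rw [← h3, ← Nat.card_coe_set_eq]
    rfl
  omega

theorem eq_of_sameFace_lift [Finite X] [Finite V] (hS : S.IsPolyhedralMap)
    (h3 : Nat.card {e : G.Dart // e.fst = v} = 3) {e f : G.Dart} (he : e.fst = v) (hf : f.fst = v)
    (hef : S.SameFace (C.lift e) (C.lift f)) : e = f :=
  (Set.ncard_le_one (Set.toFinite _)).mp (C.ncard_exits_le_one hS h3 (C.lift e)) e
    ⟨he, SameFace.refl S _⟩ f ⟨hf, hef⟩

theorem eq_of_sameFace_lift_symm [Finite X] [Finite V] (hS : S.IsPolyhedralMap)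
    (h3 : Nat.card {e : G.Dart // e.fst = v} = 3) {e f : G.Dart} (he : e.fst = v) (hf : f.fst = v)
    (hef : S.SameFace (C.lift e.symm) (C.lift f.symm)) : e = f := by
  have h := C.ncard_exits_le_one hS h3 (C.lift e.symm)
  rw [C.ncard_exits_eq_ncard_entries] at h
  exact (Set.ncard_le_one (Set.toFinite _)).mp h e ⟨he, SameFace.refl S _⟩ f ⟨hf, hef⟩

/-- The rotation system `R` is induced by `S`: it agrees with `S` away from the contracted vertex,
and it continues each face entering the contracted part with the place where it leaves this part. -/
structure Induces (C : Contraction H G v) (S : RotationSystem H) (R : RotationSystem G) :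
    Prop where
  restricts : C.Restricts S R
  sameFace : ∀ e, e.fst = v → S.SameFace (C.lift e.symm) (C.lift (R.next e))

theorem Induces.sameFace_lift [Finite V] {R : RotationSystem G} (h : C.Induces S R) {e f : G.Dart}
    (hef : R.SameFace e f) : S.SameFace (C.lift e) (C.lift f) := by
  refine Equiv.Perm.SameCycle.induction (p := fun f => S.SameFace (C.lift e) (C.lift f)) hef
    (SameFace.refl S _) fun z _ hz => hz.trans ?_
  by_cases hzv : z.snd = v
  · simpa [R.faceNext_apply] using h.sameFace z.symm hzv
  · rw [h.restricts.faceNext hzv]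
    exact S.sameFace_faceNext _

theorem Induces.eq [Finite X] [Finite V] (hS : S.IsPolyhedralMap)
    (h3 : Nat.card {e : G.Dart // e.fst = v} = 3) {R₁ R₂ : RotationSystem G} (h₁ : C.Induces S R₁)
    (h₂ : C.Induces S R₂) : R₁ = R₂ := by
  ext1
  ext1 e
  by_cases he : e.fst = v
  · exact C.eq_of_sameFace_lift hS h3 ((R₁.next_fst e).trans he) ((R₂.next_fst e).trans he)
      ((h₁.sameFace e he).symm.trans (h₂.sameFace e he))
  · exact C.lift_injective ((h₁.restricts e he).trans (h₂.restricts e he).symm)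

/-- A polyhedral embedding induces an embedding of the graph obtained by contracting one side of a
cut with three edges. -/
theorem exists_induces [Finite X] [Finite V] (C : Contraction H G v) (hS : S.IsPolyhedralMap)
    (h3 : Nat.card {e : G.Dart // e.fst = v} = 3) : ∃ R, C.Induces S R := by
  classical
  have hex : ∀ e : {e : G.Dart // e.fst = v}, ∃ f : {e : G.Dart // e.fst = v},
      S.SameFace (C.lift e.1.symm) (C.lift f) := by
    intro e
    have hpos : 0 < {f : G.Dart | f.fst = v ∧ S.SameFace (C.lift e.1.symm) (C.lift f)}.ncard := by
      rw [C.ncard_exits_eq_ncard_entries, Set.ncard_pos]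
      exact ⟨e, e.2, SameFace.refl S _⟩
    obtain ⟨f, hf, hef⟩ := (Set.ncard_pos).mp hpos
    exact ⟨⟨f, hf⟩, hef⟩
  choose θ hθ using hex
  have hθne : ∀ e, θ e ≠ e := fun e he => by
    have h1 := hθ e
    rw [he, C.lift_symm] at h1
    exact hS.not_sameFace_symm _ h1.symm
  have hθinj : Function.Injective θ := fun e f hef =>
    Subtype.ext (C.eq_of_sameFace_lift_symm hS h3 e.2 f.2
      ((hθ e).trans (by rw [hef]; exact (hθ f).symm)))
  have hnext : ∀ e : G.Dart, e.fst ≠ v → ∃ f, C.lift f = S.next (C.lift e) := fun e he =>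
    C.exists_lift _ (by rwa [S.next_fst, C.proj_fst])
  choose η hη using hnext
  let f : G.Dart → G.Dart := fun e => if he : e.fst = v then θ ⟨e, he⟩ else η e he
  have hfv : ∀ e : {e : G.Dart // e.fst = v}, f e = θ e := fun e => dif_pos e.2
  have hfn : ∀ e : G.Dart, e.fst ≠ v → C.lift (f e) = S.next (C.lift e) := fun e he => by
    rw [← hη e he]
    exact congrArg C.lift (dif_neg he)
  have hfst : ∀ e, (f e).fst = e.fst := by
    intro e
    by_cases he : e.fst = v
    · exact (congrArg (fun d : G.Dart => d.fst) (hfv ⟨e, he⟩)).trans ((θ ⟨e, he⟩).2.trans he.symm)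
    · rw [← C.proj_fst, hfn e he, S.next_fst, C.proj_fst]
  have hiter : ∀ (n : ℕ) (e : G.Dart), e.fst ≠ v →
      (f^[n] e).fst ≠ v ∧ C.lift (f^[n] e) = (S.next ^ n) (C.lift e) := by
    intro n e he
    induction n with
    | zero => exact ⟨he, rfl⟩
    | succ n ih =>
      rw [Function.iterate_succ_apply', pow_succ', Equiv.Perm.mul_apply, ← ih.2]
      exact ⟨by rw [hfst]; exact ih.1, hfn _ ih.1⟩
  let R : RotationSystem G := ofFun f hfst <| by
    intro d e hde
    by_cases hd : d.fst = v
    · have he : e.fst = v := hde ▸ hd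
      have h := Equiv.Perm.eq_or_eq_or_eq_of_card_eq_three h3
        (Equiv.ofBijective θ (Finite.injective_iff_bijective.mp hθinj)) hθne ⟨d, hd⟩ ⟨e, he⟩
      rw [Equiv.ofBijective_apply, Equiv.ofBijective_apply] at h
      rcases h with h | h | ⟨h, -⟩
      · exact ⟨0, congrArg Subtype.val h⟩
      · exact ⟨1, (hfv ⟨d, hd⟩).trans (congrArg Subtype.val h)⟩
      · refine ⟨2, ?_⟩
        change f (f d) = e
        rw [hfv ⟨d, hd⟩, hfv, h]
    · obtain ⟨n, hn⟩ := (S.sameCycle (C.lift d) (C.lift e)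
        (C.proj_inj (by rw [C.proj_fst, C.proj_fst, hde])
          (by rwa [C.proj_fst]))).exists_nat_pow_eq
      exact ⟨n, C.lift_injective ((hiter n d hd).2.trans hn)⟩
  refine ⟨R, hfn, fun e he => ?_⟩
  have h1 : R.next e = θ ⟨e, he⟩ := hfv ⟨e, he⟩
  rw [h1]
  exact hθ ⟨e, he⟩

end Contraction

namespace IsGluing

open RotationSystem

variable {X V W : Type*} {H : SimpleGraph X} {G : SimpleGraph V}
  {G' : SimpleGraph W} {v : V} {v' : W} {C : Contraction H G v} {C' : Contraction H G' v'}
  {R : RotationSystem G} {R' : RotationSystem G'} {S : RotationSystem H}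

theorem induces [Finite V] [Finite W] (h : IsGluing C C' R R' S) : C.Induces S R where
  restricts := h.restricts
  sameFace e _ := h.sameFace_lift (R.sameFace_symm_next e)

/-- A polyhedral embedding is glued from the embeddings it induces on the two sides of a cut with
three edges. -/
theorem of_induces [Finite X] [Finite V] [Finite W] (hC : C.Complementary C')
    (hS : S.IsPolyhedralMap) (h3 : Nat.card {e : G.Dart // e.fst = v} = 3)
    (h3' : Nat.card {e : G'.Dart // e.fst = v'} = 3) (h : C.Induces S R) (h' : C'.Induces S R') :
    IsGluing C C' R R' S where
  compl := hC
  restricts := h.restricts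
  restricts' := h'.restricts
  matching := by
    intro e e' he he'
    have hev : e'.fst = v' := by
      rw [← C.lift_symm] at he'
      rcases hC.fst_eq_or_snd_eq he'.symm with h1 | h1
      · exact absurd (h1.1.trans he.symm) e.snd_ne_fst
      · exact h1.2
    obtain ⟨f', hf', hfv⟩ := hC.exists_lift_eq (e := (R.next⁻¹ e).symm)
      ((R.next_inv_fst e).trans he)
    have h1 := h.sameFace (R.next⁻¹ e) ((R.next_inv_fst e).trans he)
    have h2 := h'.sameFace e' hev
    rw [R.next_next_inv, ← hf'] at h1
    rw [C'.lift_symm, he', SimpleGraph.Dart.symm_symm] at h2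
    rw [← C'.eq_of_sameFace_lift hS h3' hfv ((R'.next_fst e').trans hev) (h1.trans h2), hf',
      C.lift_symm]
  simple _ _ hef he hf := C.eq_of_sameFace_lift hS h3 he hf (h.sameFace_lift hef)
  simple' _ _ hef he hf := C'.eq_of_sameFace_lift hS h3' he hf (h'.sameFace_lift hef)

theorem eq_of_restricts (hC : C.Complementary C') {S₁ S₂ : RotationSystem H}
    (h₁ : C.Restricts S₁ R) (h₁' : C'.Restricts S₁ R') (h₂ : C.Restricts S₂ R)
    (h₂' : C'.Restricts S₂ R') : S₁ = S₂ := by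
  ext1
  ext1 d
  by_cases hd : C.proj d.fst = v
  · have hd' := (hC _).mp hd
    obtain ⟨e, rfl⟩ := C'.exists_lift d hd'
    rw [C'.proj_fst] at hd'
    rw [← h₁' e hd', ← h₂' e hd']
  · obtain ⟨e, rfl⟩ := C.exists_lift d hd
    rw [C.proj_fst] at hd
    rw [← h₁ e hd, ← h₂ e hd]

/-- Any two embeddings can be glued, as far as the rotations at the vertices are concerned. -/
theorem exists_restricts [Finite X] [Finite V] [Finite W] (hC : C.Complementary C')
    (R : RotationSystem G) (R' : RotationSystem G') :
    ∃ S : RotationSystem H, C.Restricts S R ∧ C'.Restricts S R' := by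
  classical
  have hex : ∀ d : H.Dart, C.proj d.fst = v → ∃ e, C'.lift e = d := fun d hd =>
    C'.exists_lift d ((hC _).mp hd)
  choose η hη using C.exists_lift
  choose η' hη' using hex
  let f : H.Dart → H.Dart := fun d =>
    if hd : C.proj d.fst = v then C'.lift (R'.next (η' d hd)) else C.lift (R.next (η d hd))
  have hf : ∀ e, e.fst ≠ v → f (C.lift e) = C.lift (R.next e) := fun e he => by
    have hd : C.proj (C.lift e).fst ≠ v := by rwa [C.proj_fst]
    have h1 : f (C.lift e) = C.lift (R.next (η _ hd)) := dif_neg hd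
    rw [h1, C.lift_injective (hη _ hd)]
  have hf' : ∀ e, e.fst ≠ v' → f (C'.lift e) = C'.lift (R'.next e) := fun e he => by
    have hd : C.proj (C'.lift e).fst = v := (hC _).mpr (by rwa [C'.proj_fst])
    have h1 : f (C'.lift e) = C'.lift (R'.next (η' _ hd)) := dif_pos hd
    rw [h1, C'.lift_injective (hη' _ hd)]
  have hfst : ∀ d, (f d).fst = d.fst := by
    intro d
    by_cases hd : C.proj d.fst = v
    · have hd' := (hC _).mp hd
      obtain ⟨e, rfl⟩ := C'.exists_lift d hd'
      rw [C'.proj_fst] at hd'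
      rw [hf' e hd']
      exact C'.proj_inj (by rw [C'.proj_fst, C'.proj_fst, R'.next_fst])
        (by rwa [C'.proj_fst, R'.next_fst])
    · obtain ⟨e, rfl⟩ := C.exists_lift d hd
      rw [C.proj_fst] at hd
      rw [hf e hd]
      exact C.proj_inj (by rw [C.proj_fst, C.proj_fst, R.next_fst])
        (by rwa [C.proj_fst, R.next_fst])
  have hiter : ∀ (n : ℕ) (e : G.Dart), e.fst ≠ v → f^[n] (C.lift e) = C.lift ((R.next ^ n) e) := by
    intro n e he
    induction n with
    | zero => rfl
    | succ n ih =>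
      rw [Function.iterate_succ_apply', ih, hf, pow_succ', Equiv.Perm.mul_apply]
      rwa [R.next_pow_fst]
  have hiter' : ∀ (n : ℕ) (e : G'.Dart), e.fst ≠ v' →
      f^[n] (C'.lift e) = C'.lift ((R'.next ^ n) e) := by
    intro n e he
    induction n with
    | zero => rfl
    | succ n ih =>
      rw [Function.iterate_succ_apply', ih, hf', pow_succ', Equiv.Perm.mul_apply]
      rwa [R'.next_pow_fst]
  refine ⟨ofFun f hfst fun d e hde => ?_, fun e he => (hf e he).symm, fun e he => (hf' e he).symm⟩
  by_cases hd : C.proj d.fst = v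
  · have hd' := (hC _).mp hd
    obtain ⟨a, rfl⟩ := C'.exists_lift d hd'
    obtain ⟨b, rfl⟩ := C'.exists_lift e (hde ▸ hd')
    obtain ⟨n, hn⟩ := (R'.sameCycle a b
      (by rw [← C'.proj_fst, hde, C'.proj_fst])).exists_nat_pow_eq
    rw [C'.proj_fst] at hd'
    exact ⟨n, by rw [hiter' n a hd', hn]⟩
  · obtain ⟨a, rfl⟩ := C.exists_lift d hd
    obtain ⟨b, rfl⟩ := C.exists_lift e (hde ▸ hd)
    obtain ⟨n, hn⟩ := (R.sameCycle a b
      (by rw [← C.proj_fst, hde, C.proj_fst])).exists_nat_pow_eq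
    rw [C.proj_fst] at hd
    exact ⟨n, by rw [hiter n a hd, hn]⟩

/-- The rotations at two vertices of degree three match up to a reflection. -/
theorem matching_or_matching_mirror [Finite V] [Finite W] (hC : C.Complementary C')
    (h3 : Nat.card {e : G.Dart // e.fst = v} = 3) (h3' : Nat.card {e : G'.Dart // e.fst = v'} = 3)
    (R : RotationSystem G) (R' : RotationSystem G') :
    C.Matching C' R R' ∨ C.Matching C' R R'.mirror := by
  have hex : ∀ e : {e : G.Dart // e.fst = v}, ∃ e' : {e : G'.Dart // e.fst = v'},
      C'.lift e' = (C.lift e).symm := fun e => by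
    obtain ⟨e', he', hev⟩ := hC.exists_lift_eq (e := e.1.symm) e.2
    exact ⟨⟨e', hev⟩, by rw [he', C.lift_symm]⟩
  choose p hp using hex
  have hpinj : Function.Injective p := fun e f hef => by
    have h1 := hp e
    rw [hef, hp f] at h1
    exact Subtype.ext (C.lift_injective (SimpleGraph.Dart.symm_involutive.injective h1)).symm
  have hT : Finite {e : G'.Dart // e.fst = v'} := inferInstance
  let q : {e : G.Dart // e.fst = v} ≃ {e : G'.Dart // e.fst = v'} :=
    Equiv.ofBijective p ((Nat.bijective_iff_injective_and_card p).mpr ⟨hpinj, h3.trans h3'.symm⟩)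
  have hmatch : ∀ T : RotationSystem G',
      T.rotationAt v' = q.permCongr (R.rotationAt v)⁻¹ → C.Matching C' R T := by
    intro T hT e e' he he'
    have h1 : q ⟨e, he⟩ = p ⟨e, he⟩ := rfl
    have h2 : e' = p ⟨e, he⟩ := C'.lift_injective (he'.trans (hp ⟨e, he⟩).symm)
    rw [h2, ← T.rotationAt_apply, hT, Equiv.permCongr_apply, ← h1, Equiv.symm_apply_apply]
    exact hp _
  rcases (R'.rotationAt v').eq_or_eq_inv_of_card_eq_three h3'
    (q.permCongr (R.rotationAt v)⁻¹) (R'.rotationAt_ne h3') (fun i hi => by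
      rw [Equiv.permCongr_apply, ← Equiv.eq_symm_apply, Equiv.Perm.inv_eq_iff_eq] at hi
      exact R.rotationAt_ne h3 _ hi.symm) with h | h
  · exact Or.inl (hmatch R' h)
  · refine Or.inr (hmatch R'.mirror ?_)
    have h1 : R'.mirror.rotationAt v' = (R'.rotationAt v')⁻¹ := rfl
    rw [h1, h, inv_inv]

end IsGluing

/-! ### Counting polyhedral embeddings across a cut with three edges -/

namespace RotationSystem

/-- A correspondence between two sets of rotation systems that commutes with taking
mirror images induces a bijection of the sets of mirror classes. -/
theorem ncard_image_mk_eq {X V : Type*} {H : SimpleGraph X} {G : SimpleGraph V}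
    {B : Set (RotationSystem H)} {A : Set (RotationSystem G)}
    (ρ : RotationSystem G → RotationSystem H → Prop)
    (hA : ∀ R ∈ A, ∃ S ∈ B, ρ R S) (hB : ∀ S ∈ B, ∃ R ∈ A, ρ R S)
    (hmirror : ∀ R S, ρ R S → ρ R.mirror S.mirror) (hBm : ∀ S ∈ B, S.mirror ∈ B)
    (hR : ∀ S ∈ B, ∀ R₁ R₂, ρ R₁ S → ρ R₂ S → R₁ = R₂)
    (hS : ∀ R, ∀ S₁ ∈ B, ∀ S₂ ∈ B, ρ R S₁ → ρ R S₂ → S₁ = S₂) :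
    (Quotient.mk (mirrorSetoid H) '' B).ncard = (Quotient.mk (mirrorSetoid G) '' A).ncard := by
  symm
  have hex : ∀ a ∈ Quotient.mk (mirrorSetoid G) '' A,
      ∃ R S, Quotient.mk (mirrorSetoid G) R = a ∧ S ∈ B ∧ ρ R S := by
    rintro _ ⟨R, hRA, rfl⟩
    obtain ⟨S, hSB, hRS⟩ := hA R hRA
    exact ⟨R, S, rfl, hSB, hRS⟩
  choose r s hr hsB hrs using hex
  refine Set.ncard_congr (fun a ha => Quotient.mk (mirrorSetoid H) (s a ha))
    (fun a ha => ⟨_, hsB a ha, rfl⟩) (fun a b ha hb hab => ?_) ?_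
  · rw [← hr a ha, ← hr b hb]
    refine Quotient.sound ?_
    rcases Quotient.exact hab with h | h
    · exact Or.inl (hR _ (hsB b hb) _ _ (hrs b hb) (h ▸ hrs a ha))
    · exact Or.inr (hR _ (hsB b hb) _ _ (hrs b hb) (h ▸ hmirror _ _ (hrs a ha)))
  · rintro _ ⟨S, hSB, rfl⟩
    obtain ⟨R, hRA, hRS⟩ := hB S hSB
    have ha : Quotient.mk (mirrorSetoid G) R ∈ Quotient.mk (mirrorSetoid G) '' A := ⟨R, hRA, rfl⟩
    refine ⟨_, ha, Quotient.sound ?_⟩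
    rcases Quotient.exact (hr _ ha) with h | h
    · have h1 := hrs _ ha
      rw [← h] at h1
      exact Or.inl (hS R _ hSB _ (hsB _ ha) hRS h1)
    · refine Or.inr ?_
      have h1 := hmirror _ _ (hrs _ ha)
      rw [← h] at h1
      exact hS R _ hSB _ (hBm _ (hsB _ ha)) hRS h1

end RotationSystem

theorem SimpleGraph.Connected.exists_adj_of_dart {V : Type*} {G : SimpleGraph V} (hG : G.Connected)
    (d : G.Dart) (x : V) : ∃ y, G.Adj x y :=
  (hG.preconnected d.fst x).induction (p := fun x => ∃ y, G.Adj x y) ⟨_, d.adj⟩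
    fun a _ hab _ => ⟨a, hab.symm⟩

section Count

open RotationSystem

variable {X V W : Type*} [Finite X] [Finite V] [Finite W] {H : SimpleGraph X} {G : SimpleGraph V}
  {G' : SimpleGraph W} {v : V} {v' : W} {C : Contraction H G v} {C' : Contraction H G' v'}

/-- Gluing with a spherical embedding at a vertex of degree three preserves the genus. -/
theorem IsGluing.hasGenus_iff {R : RotationSystem G} {R' : RotationSystem G'}
    {S : RotationSystem H} (h : IsGluing C C' R R' S) (hR' : R'.HasGenus 0) (hH : H.Connected)
    (hG : G.Connected) (hG' : G'.Connected) (hcard : Nat.card X + 2 = Nat.card V + Nat.card W)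
    (h3 : Nat.card {e : G.Dart // e.fst = v} = 3) {g : ℕ} : S.HasGenus g ↔ R.HasGenus g := by
  obtain ⟨d, hd⟩ : Nonempty {e : G.Dart // e.fst = v} := (Nat.card_pos_iff.mp (by omega)).1
  obtain ⟨d', -, -⟩ := h.compl.exists_lift_eq (e := d.symm) hd
  rw [RotationSystem.hasGenus_iff hH (hH.exists_adj_of_dart (C.lift d)),
    RotationSystem.hasGenus_iff hG (hG.exists_adj_of_dart d)]
  rw [RotationSystem.hasGenus_iff hG' (hG'.exists_adj_of_dart d')] at hR'
  have h1 := h.card_faces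
  have h2 := h.compl.card_dart
  rw [H.card_dart_eq, G.card_dart_eq, G'.card_dart_eq] at h2
  omega

/-- If one side of a cut with three edges is a 3-connected planar graph, then it can be contracted
without changing the number of polyhedral embeddings of a given genus. -/
theorem Contraction.Complementary.numPolyhedral_eq (hC : C.Complementary C')
    (hcard : Nat.card X + 2 = Nat.card V + Nat.card W) (hconn : H.Connected ↔ G.Connected)
    (h3 : Nat.card {e : G.Dart // e.fst = v} = 3) (h3' : Nat.card {e : G'.Dart // e.fst = v'} = 3)
    (hG' : IsVertexConnected G' 3) (hplanar : IsPlanarGraph G') (g : ℕ) :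
    numPolyhedral H g = numPolyhedral G g := by
  obtain ⟨P, hP⟩ := hplanar
  have hPpoly := isPolyhedralMap_of_isVertexConnected hG' hP
  have hG'conn := hG'.connected (by norm_num)
  -- A polyhedral embedding of the glued graph has a spherical part on the planar side.
  have hsplit : ∀ (S : RotationSystem H) (R : RotationSystem G) (R' : RotationSystem G'),
      S.IsPolyhedralMap → IsGluing C C' R R' S → R' = P ∨ R' = P.mirror := fun S R R' hS h =>
    (h.symm.isPolyhedralMap_left hS hG'conn (fun _ => R'.next_ne_of_card_eq_three h3')
      fun _ _ => R'.next_eq_or_next_eq h3').eq_or_eq_mirror_of_hasGenus_zero hP hG'.exists_adj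
  refine ncard_image_mk_eq (fun R S => ∃ R', IsGluing C C' R R' S) ?_ ?_ ?_ ?_ ?_ ?_
  · rintro R ⟨hR, hg⟩
    rw [isPolyhedral_iff] at hR
    obtain ⟨P', hP', hP'poly, hm⟩ : ∃ P' : RotationSystem G', P'.HasGenus 0 ∧
        P'.IsPolyhedralMap ∧ C.Matching C' R P' := by
      rcases IsGluing.matching_or_matching_mirror hC h3 h3' R P with h | h
      · exact ⟨P, hP, hPpoly, h⟩
      · exact ⟨P.mirror, hP.mirror, hPpoly.mirror, h⟩
    obtain ⟨S, hS, hS'⟩ := IsGluing.exists_restricts hC R P'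
    have hglue : IsGluing C C' R P' S := ⟨hC, hS, hS', hm,
      fun _ _ hef he hf => hR.simple hef (he.trans hf.symm),
      fun _ _ hef he hf => hP'poly.simple hef (he.trans hf.symm)⟩
    have hH := hconn.mpr hR.connected
    exact ⟨S, ⟨isPolyhedral_iff.mpr (hglue.isPolyhedralMap hR hP'poly hH),
      (hglue.hasGenus_iff hP' hH hR.connected hG'conn hcard h3).mpr hg⟩, P', hglue⟩
  · rintro S ⟨hS, hg⟩
    rw [isPolyhedral_iff] at hS
    obtain ⟨R, hR⟩ := C.exists_induces hS h3
    obtain ⟨R', hR'⟩ := C'.exists_induces hS h3'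
    have hglue := IsGluing.of_induces hC hS h3 h3' hR hR'
    have hG := hconn.mp hS.connected
    have hR'g : R'.HasGenus 0 := by
      rcases hsplit S R R' hS hglue with rfl | rfl
      · exact hP
      · exact hP.mirror
    exact ⟨R, ⟨isPolyhedral_iff.mpr (hglue.isPolyhedralMap_left hS hG
      (fun _ => R.next_ne_of_card_eq_three h3) fun _ _ => R.next_eq_or_next_eq h3),
      (hglue.hasGenus_iff hR'g hS.connected hG hG'conn hcard h3).mp hg⟩, R', hglue⟩
  · rintro R S ⟨R', h⟩
    exact ⟨R'.mirror, h.mirror⟩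
  · rintro S ⟨hS, hg⟩
    exact ⟨isPolyhedral_iff.mpr (isPolyhedral_iff.mp hS).mirror, hg.mirror⟩
  · rintro S ⟨hS, -⟩ R₁ R₂ ⟨R₁', h₁⟩ ⟨R₂', h₂⟩
    exact h₁.induces.eq (isPolyhedral_iff.mp hS) h3 h₂.induces
  · rintro R S₁ ⟨hS₁, -⟩ S₂ ⟨hS₂, -⟩ ⟨R₁', h₁⟩ ⟨R₂', h₂⟩
    -- Only one of `P` and its mirror image fits the rotation of `R` at the contracted vertex.
    have hR' : R₁' = R₂' := by
      obtain ⟨e, he⟩ : Nonempty {e : G.Dart // e.fst = v} := (Nat.card_pos_iff.mp (by omega)).1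
      obtain ⟨e', he', -⟩ := hC.exists_lift_eq (e := e.symm) he
      rw [C.lift_symm] at he'
      have h := C'.lift_injective ((h₁.matching e e' he he').trans (h₂.matching e e' he he').symm)
      have hne : P.next e' ≠ P.mirror.next e' := fun h' => hG'.next_next_ne P e' (by
        rw [h', mirror_next, P.next_next_inv])
      rcases hsplit S₁ R R₁' (isPolyhedral_iff.mp hS₁) h₁ with rfl | rfl <;>
        rcases hsplit S₂ R R₂' (isPolyhedral_iff.mp hS₂) h₂ with rfl | rfl
      · rfl
      · exact absurd h hne
      · exact absurd h.symm hne
      · rfl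
    subst hR'
    exact IsGluing.eq_of_restricts hC h₁.restricts h₁.restricts' h₂.restricts h₂.restricts'

end Count

/-! ### The star product -/

section StarProduct

variable {V W : Type*} {G : SimpleGraph V} {v : V} {G' : SimpleGraph W} {v' : W}

/-- The start of the edge of the star product that comes from a directed edge of `G`. -/
def starProductLiftFst (σ : G.neighborSet v ≃ G'.neighborSet v') [DecidableEq V] (e : G.Dart) :
    {x : V // x ≠ v} ⊕ {y : W // y ≠ v'} :=
  if h : e.fst = v then
    have hs : e.snd ∈ G.neighborSet v := h ▸ e.adj
    Sum.inr ⟨σ ⟨e.snd, hs⟩, (SimpleGraph.ne_of_adj _ (σ ⟨e.snd, hs⟩).2).symm⟩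
  else Sum.inl ⟨e.fst, h⟩

theorem starProductLiftFst_of_eq (σ : G.neighborSet v ≃ G'.neighborSet v') [DecidableEq V]
    {e : G.Dart} (h : e.fst = v) : ∃ (hs : e.snd ∈ G.neighborSet v) (hn : _),
      starProductLiftFst σ e = Sum.inr ⟨σ ⟨e.snd, hs⟩, hn⟩ :=
  ⟨h ▸ e.adj, _, dif_pos h⟩

theorem starProductLiftFst_of_ne (σ : G.neighborSet v ≃ G'.neighborSet v') [DecidableEq V]
    {e : G.Dart} (h : e.fst ≠ v) : starProductLiftFst σ e = Sum.inl ⟨e.fst, h⟩ :=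
  dif_neg h

theorem starProductLiftFst_adj (σ : G.neighborSet v ≃ G'.neighborSet v') [DecidableEq V]
    (e : G.Dart) : (starProduct G v G' v' σ).Adj (starProductLiftFst σ e)
      (starProductLiftFst σ e.symm) := by
  by_cases h1 : e.fst = v
  · have h2 : e.symm.fst ≠ v := fun h2 => e.fst_ne_snd (h1.trans h2.symm)
    obtain ⟨hs, hn, h3⟩ := starProductLiftFst_of_eq σ h1
    rw [h3, starProductLiftFst_of_ne σ h2]
    exact ⟨hs, rfl⟩
  · by_cases h2 : e.symm.fst = v
    · obtain ⟨hs, hn, h3⟩ := starProductLiftFst_of_eq σ h2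
      rw [h3, starProductLiftFst_of_ne σ h1]
      exact ⟨hs, rfl⟩
    · rw [starProductLiftFst_of_ne σ h1, starProductLiftFst_of_ne σ h2]
      exact e.adj

/-- The contraction of the second factor of a star product. -/
noncomputable def starProductContraction (σ : G.neighborSet v ≃ G'.neighborSet v') :
    Contraction (starProduct G v G' v' σ) G v := by
  classical
  exact
  { proj := Sum.elim Subtype.val fun _ => v
    lift := fun e => SimpleGraph.Dart.mk (starProductLiftFst σ e, starProductLiftFst σ e.symm)
      (starProductLiftFst_adj σ e)
    lift_symm := fun e => rfl
    proj_fst := fun e => by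
      by_cases h : e.fst = v
      · obtain ⟨hs, hn, h3⟩ := starProductLiftFst_of_eq σ h
        dsimp only
        rw [h3, h]
        rfl
      · dsimp only
        rw [starProductLiftFst_of_ne σ h]
        rfl
    proj_inj := by
      rintro (x | x) (y | y) h hx
      · exact congrArg Sum.inl (Subtype.ext h)
      · exact absurd h hx
      · exact absurd rfl hx
      · exact absurd rfl hx
    exists_lift := by
      rintro ⟨⟨x | x, y | y⟩, h⟩ hx
      · refine ⟨SimpleGraph.Dart.mk (x.1, y.1) h, SimpleGraph.Dart.eq_of_fst_of_snd ?_ ?_⟩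
        · exact starProductLiftFst_of_ne σ (e := SimpleGraph.Dart.mk (x.1, y.1) h) x.2
        · exact starProductLiftFst_of_ne σ (e := (SimpleGraph.Dart.mk (x.1, y.1) h).symm) y.2
      · obtain ⟨hs, hy⟩ := h
        have hs' : G.Adj x v := G.adj_symm hs
        refine ⟨SimpleGraph.Dart.mk (x.1, v) hs', SimpleGraph.Dart.eq_of_fst_of_snd ?_ ?_⟩
        · exact starProductLiftFst_of_ne σ (e := SimpleGraph.Dart.mk (x.1, v) hs') x.2
        · obtain ⟨_, _, h3⟩ := starProductLiftFst_of_eq σ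
            (e := (SimpleGraph.Dart.mk (x.1, v) hs').symm) rfl
          exact h3.trans (congrArg Sum.inr (Subtype.ext hy))
      · exact absurd rfl hx
      · exact absurd rfl hx }

/-- A contraction of a graph is also a contraction of any isomorphic graph. -/
def Contraction.comap {X Y V : Type*} {H : SimpleGraph X} {K : SimpleGraph Y} {G : SimpleGraph V}
    {v : V} (φ : H ≃g K) (C : Contraction K G v) : Contraction H G v where
  proj x := C.proj (φ x)
  lift e := φ.symm.toHom.mapDart (C.lift e)
  lift_symm e := by
    rw [C.lift_symm]
    rfl
  proj_fst e := by
    change C.proj (φ (φ.symm _)) = _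
    rw [φ.apply_symm_apply, C.proj_fst]
  proj_inj x y h hx := φ.injective (C.proj_inj h hx)
  exists_lift d hd := by
    obtain ⟨e, he⟩ := C.exists_lift (φ.toHom.mapDart d) hd
    refine ⟨e, ?_⟩
    rw [he]
    exact SimpleGraph.Dart.eq_of_fst_of_snd (φ.symm_apply_apply _) (φ.symm_apply_apply _)

/-- The star product is commutative. -/
def starProductSwap (σ : G.neighborSet v ≃ G'.neighborSet v') :
    starProduct G v G' v' σ ≃g starProduct G' v' G v σ.symm where
  toEquiv := Equiv.sumComm _ _
  map_rel_iff' := by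
    have key : ∀ (x : {x : V // x ≠ v}) (y : {y : W // y ≠ v'}),
        (∃ h : (y : W) ∈ G'.neighborSet v', (σ.symm ⟨y, h⟩ : V) = x) ↔
          ∃ h : (x : V) ∈ G.neighborSet v, (σ ⟨x, h⟩ : W) = y := by
      intro x y
      constructor
      · rintro ⟨h, hx⟩
        have h1 : (x : V) ∈ G.neighborSet v := hx ▸ (σ.symm ⟨y, h⟩).2
        refine ⟨h1, ?_⟩
        have h2 : (⟨x, h1⟩ : G.neighborSet v) = σ.symm ⟨y, h⟩ := Subtype.ext hx.symm
        rw [h2, Equiv.apply_symm_apply]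
      · rintro ⟨h, hy⟩
        have h1 : (y : W) ∈ G'.neighborSet v' := hy ▸ (σ ⟨x, h⟩).2
        refine ⟨h1, ?_⟩
        have h2 : (⟨y, h1⟩ : G'.neighborSet v') = σ ⟨x, h⟩ := Subtype.ext hy.symm
        rw [h2, Equiv.symm_apply_apply]
    rintro (x | x) (y | y)
    · exact Iff.rfl
    · exact key x y
    · exact key y x
    · exact Iff.rfl

theorem starProductContraction_complementary (σ : G.neighborSet v ≃ G'.neighborSet v') :
    (starProductContraction σ).Complementary
      ((starProductContraction σ.symm).comap (starProductSwap σ)) := by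
  rintro (x | x)
  · exact iff_of_false x.2 (fun h => h rfl)
  · exact iff_of_true rfl x.2

theorem card_darts_fst_eq (h : (G.neighborSet v).ncard = 3) :
    Nat.card {e : G.Dart // e.fst = v} = 3 := by
  rw [← h, ← Nat.card_coe_set_eq]
  refine Nat.card_congr ⟨fun e => ⟨e.1.snd, by have h := e.1.adj; rwa [e.2] at h⟩,
    fun x => ⟨SimpleGraph.Dart.mk (v, x) x.2, rfl⟩, ?_, fun x => rfl⟩
  rintro ⟨e, rfl⟩
  rfl

theorem card_starProduct_vertices [Finite V] [Finite W] (v : V) (v' : W) :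
    Nat.card ({x : V // x ≠ v} ⊕ {y : W // y ≠ v'}) + 2 = Nat.card V + Nat.card W := by
  classical
  have : Fintype V := Fintype.ofFinite V
  have : Fintype W := Fintype.ofFinite W
  have h1 : 0 < Fintype.card V := Fintype.card_pos_iff.mpr ⟨v⟩
  have h2 : 0 < Fintype.card W := Fintype.card_pos_iff.mpr ⟨v'⟩
  simp only [Nat.card_eq_fintype_card, Fintype.card_sum, Fintype.card_subtype_compl,
    Fintype.card_unique]
  omega

theorem connected_starProduct_iff (σ : G.neighborSet v ≃ G'.neighborSet v')
    (hne : (G.neighborSet v).Nonempty) (hG' : (G'.induce {y | y ≠ v'}).Connected) :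
    (starProduct G v G' v' σ).Connected ↔ G.Connected := by
  obtain ⟨a, ha⟩ := hne
  have hright : ∀ y y' : {y : W // y ≠ v'},
      (starProduct G v G' v' σ).Reachable (Sum.inr y) (Sum.inr y') := fun y y' =>
    (hG'.preconnected y y').induction
      (p := fun y' => (starProduct G v G' v' σ).Reachable (Sum.inr y) (Sum.inr y'))
      (SimpleGraph.Reachable.refl _) fun b c hbc hb =>
        hb.trans (SimpleGraph.Adj.reachable (G := starProduct G v G' v' σ) hbc)
  have hcross : ∀ (x : {x : V // x ≠ v}) (h : (x : V) ∈ G.neighborSet v),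
      ∃ y, (starProduct G v G' v' σ).Adj (Sum.inl x) (Sum.inr y) := fun x h =>
    ⟨⟨σ ⟨x, h⟩, (SimpleGraph.ne_of_adj _ (σ ⟨x, h⟩).2).symm⟩, h, rfl⟩
  obtain ⟨b, hab⟩ := hcross ⟨a, (SimpleGraph.ne_of_adj _ ha).symm⟩ ha
  constructor
  · intro h
    have hto : ∀ z, G.Reachable a (Sum.elim Subtype.val (fun _ => v) z) := fun z =>
      (h.preconnected (Sum.inr b) z).induction
        (p := fun z => G.Reachable a (Sum.elim Subtype.val (fun _ => v) z))
        (SimpleGraph.Adj.reachable (G.adj_symm ha)) (by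
          rintro (x | x) (y | y) hxy hx
          · exact hx.trans (SimpleGraph.Adj.reachable (G := G) hxy)
          · obtain ⟨hs, -⟩ := hxy
            exact hx.trans (SimpleGraph.Adj.reachable (G.adj_symm hs))
          · obtain ⟨hs, -⟩ := hxy
            exact hx.trans (SimpleGraph.Adj.reachable hs)
          · exact hx)
    have hto' : ∀ x, G.Reachable a x := fun x => by
      by_cases hx : x = v
      · rw [hx]
        exact hto (Sum.inr b)
      · exact hto (Sum.inl ⟨x, hx⟩)
    have : Nonempty V := ⟨v⟩
    exact ⟨fun x y => (hto' x).symm.trans (hto' y)⟩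
  · intro h
    have hto : ∀ (x : V) (hx : x ≠ v),
        (starProduct G v G' v' σ).Reachable (Sum.inr b) (Sum.inl ⟨x, hx⟩) := fun x =>
      (h.preconnected v x).induction
        (p := fun x => ∀ hx : x ≠ v,
          (starProduct G v G' v' σ).Reachable (Sum.inr b) (Sum.inl ⟨x, hx⟩))
        (fun hx => absurd rfl hx) fun x y hxy ih hy => by
          by_cases hx : x = v
          · obtain ⟨c, hc⟩ := hcross ⟨y, hy⟩ (show G.Adj v y from hx ▸ hxy)
            exact (hright b c).trans hc.symm.reachable
          · exact (ih hx).trans (SimpleGraph.Adj.reachable (G := starProduct G v G' v' σ)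
              (u := Sum.inl ⟨x, hx⟩) (v := Sum.inl ⟨y, hy⟩) hxy)
    have hto' : ∀ z, (starProduct G v G' v' σ).Reachable (Sum.inr b) z := by
      rintro (x | y)
      · exact hto x.1 x.2
      · exact hright b y
    have : Nonempty ({x : V // x ≠ v} ⊕ {y : W // y ≠ v'}) := ⟨Sum.inr b⟩
    exact ⟨fun x y => (hto' x).symm.trans (hto' y)⟩

end StarProduct

theorem mainTheorem8 {V : Type*} {W : Type*} [Finite V] [Finite W]
    (G : SimpleGraph V) (G' : SimpleGraph W) (v : V) (v' : W)
    (hv : (G.neighborSet v).ncard = 3) (hv' : (G'.neighborSet v').ncard = 3)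
    (σ : G.neighborSet v ≃ G'.neighborSet v')
    (hconn : IsVertexConnected G' 3) (hplanar : IsPlanarGraph G') (g : ℕ) :
    numPolyhedral (starProduct G v G' v' σ) g = numPolyhedral G g := by
  have hdel : (G'.induce {y | y ≠ v'}).Connected := by
    have h := hconn.2 {v'} (by simp)
    have hset : {y | y ∉ ({v'} : Finset W)} = {y | y ≠ v'} := by
      ext y
      simp
    rwa [hset] at h
  exact (starProductContraction_complementary σ).numPolyhedral_eq (card_starProduct_vertices v v')
    (connected_starProduct_iff σ (Set.nonempty_of_ncard_ne_zero (by omega)) hdel)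
    (card_darts_fst_eq hv) (card_darts_fst_eq hv') hconn hplanar g
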